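/- **Model.** Fix $\lambda_2>0$, $M_{R2}>0$ and an SNR threshold $\Gamma_{th}$. In every time slot the routing protocol is in one of the transmitter-candidate states $\{S\}$, $\{S,R1\}$, $\{S,R2\}$, $(S,R1,R2)_1$, $(S,R1,R2)_2$, $(S,R1,R2)_3$; write $TCs(i)$ for the state in slot $i$ and $TCs(i)=\{S,R1,R2\}$ if it is one of the last three. Let $\gamma_{overall2},\gamma_{overall3}$ be the SNR already accumulated at the destination $D$ in the states $\{S,R2\}$, $\{S,R1,R2\}$, and let $\gamma_{SD}(i),\gamma_{R2D}(i)$ be the link SNRs in slot $i$. Consider the failure events $$\mathbb M:\ \gamma_{overall2}+\gamma_{SD}(i)<\Gamma_{th},\quad \mathbb N:\ \gamma_{overall2}+\gamma_{R2D}(i)<\Gamma_{th},\quad \mathbb O:\ \gamma_{overall3}+\gamma_{SD}(i)<\Gamma_{th},\quad \mathbb F:\ \gamma_{overall3}+\gamma_{R2D}(i)<\Gamma_{th}.$$ The slot records (the state $TCs(i)$ together with the four combined SNRs) are i.i.d. over $i$ with an arbitrary joint law. The harvested energies $X(i)$ are i.i.d. exponential with mean $1/\lambda_2$. The initial level $B_2(0)\ge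 0$ has an arbitrary law, and $B_2(0)$, the slot records and the energies are independent of each other. The energy buffer of relay R2 evolves by $$B_2(i+1)=\begin{cases}B_2(i)-M_{R2}+X(i), & B_2(i)\ge M_{R2}\text{ and } \big[(TCs(i)=\{S,R2\},\ \mathbb M,\ \overline{\mathbb N})\text{ or }(TCs(i)=\{S,R1,R2\},\ \mathbb O,\ \overline{\mathbb F})\big],\\ B_2(i)+X(i), & \text{otherwise.}\end{cases}$$ Let $p_{SR2},p_1,p_2,p_3$ be the probabilities of the states $\{S,R2\}$, $(S,R1,R2)_1$, $(S,R1,R2)_2$, $(S,R1,R2)_3$. Let $\mathfrak m=\Pr(\mathbb M\mid TCs=\{S,R2\})$, $\mathfrak n=\Pr(\mathbb N\mid TCs=\{S,R2\},\mathbb M)$, $\mathfrak o=\Pr(\mathbb O\mid TCs=\{S,R1,R2\})$ and $\mathfrak f=\Pr(\mathbb F\mid TCs=\{S,R1,R2\},\mathbb O)$; the conditions $\mathbb M$ and $\mathbb O$ in $\mathfrak n$ and $\mathfrak f$ are immaterial when, given the state, the failures of the two links are independent. (A conditional probability given a null event is $0$.) Put $$b_2=p_{SR2}\,\mathfrak m(1-\mathfrak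 n)+(p_1+p_2+p_3)\,\mathfrak o(1-\mathfrak f),\qquad \psi_{R2}=\lambda_2M_{R2}b_2 .$$ **Theorem.** Suppose $\psi_{R2}>1$. With the principal branch $W$ of the Lambert function (the inverse of $w\mapsto we^w$ on $[-1,\infty)$) put $$Q_2=\frac{-W\!\left(-b_2\lambda_2M_{R2}e^{-b_2\lambda_2M_{R2}}\right)}{M_{R2}}-b_2\lambda_2 .$$ Then $Q_2<0$, and $Q_2$ is the unique nonzero real solution of $b_2\lambda_2e^{Q_2M_{R2}}=b_2\lambda_2+Q_2$. The function $$g_2(x)=\begin{cases}0,&x<0,\\ \dfrac1{M_{R2}}\left(1-e^{Q_2x}\right),&0\le x<M_{R2},\\[2mm] \dfrac1{M_{R2}}\,\dfrac{-Q_2e^{Q_2x}}{b_2\lambda_2+Q_2},&x\ge M_{R2},\end{cases}$$ is a probability density. The law with density $g_2$ is a stationary distribution of the process $B_2$, and it is the only stationary distribution on $[0,\infty)$. It is also the limiting distribution: for every initial law on $[0,\infty)$ and every Borel set $A\subseteq\mathbb R$, $\Pr\{B_2(i)\in A\}\to\int_A g_2(x)\,dx$ as $i\to\infty$. -/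

import Mathlib

open MeasureTheory ProbabilityTheory Filter Topology

noncomputable section

/-- The transmitter-candidate sets: `{S}`, `{S,R1}`, `{S,R2}` and the three variants of
`{S,R1,R2}`. -/
inductive TCState where
  | S | SR1 | SR2 | SR1R2₁ | SR1R2₂ | SR1R2₃

instance : MeasurableSpace TCState := ⊤

/-- The four transmissions to `D` that decide whether `R2` spends energy:
from `S` or from `R2`, while the candidate set is `{S,R2}` or one of the `{S,R1,R2}`. -/
inductive Attempt where
  | S_of_SR2 | R2_of_SR2 | S_of_SR1R2 | R2_of_SR1R2

/-- What the routing protocol sees in one time slot, as far as `R2` is concerned: the current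
candidate set, and for each attempt the SNR that `D` would have after maximal ratio combining, i.e.
the SNR accumulated so far plus the SNR of the attempted link in this slot
(`γ_overall2 + γ_SD`, `γ_overall2 + γ_R2D`, `γ_overall3 + γ_SD`, `γ_overall3 + γ_R2D`). -/
abbrev Slot := TCState × (Attempt → ℝ)

/-- The candidate set is `c`. -/
def tcIs (c : TCState) : Set Slot := {s | s.1 = c}

/-- The candidate set is `{S,R1,R2}`, in any of its three variants. -/
def tcAll : Set Slot := tcIs .SR1R2₁ ∪ tcIs .SR1R2₂ ∪ tcIs .SR1R2₃

/-- The attempt `a` would fail: the combined SNR at `D` stays below the threshold `Γ`. -/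
def fails (Γ : ℝ) (a : Attempt) : Set Slot := {s | s.2 a < Γ}

/-- The slots in which the protocol lets `R2` transmit if `R2` has enough energy: `R2` holds the
packet, `S → D` would fail and `R2 → D` would succeed. -/
def dischargeSlots (Γ : ℝ) : Set Slot :=
  (tcIs .SR2 ∩ fails Γ .S_of_SR2 ∩ (fails Γ .R2_of_SR2)ᶜ) ∪
    (tcAll ∩ fails Γ .S_of_SR1R2 ∩ (fails Γ .R2_of_SR1R2)ᶜ)

/-- The probability of the candidate set `c`, under the law `ρ` of a slot. -/
def probTC (ρ : Measure Slot) (c : TCState) : ℝ := ρ.real (tcIs c)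

/-- The probability `𝔪` that `S → D` fails when the candidate set is `{S,R2}`. -/
def probM (ρ : Measure Slot) (Γ : ℝ) : ℝ :=
  (ρ[|tcIs .SR2]).real (fails Γ .S_of_SR2)

/-- The probability `𝔫` that `R2 → D` fails when the candidate set is `{S,R2}` (and `S → D` fails,
which is when `R2` is considered; this condition is immaterial if the two are independent). -/
def probN (ρ : Measure Slot) (Γ : ℝ) : ℝ :=
  (ρ[|tcIs .SR2 ∩ fails Γ .S_of_SR2]).real (fails Γ .R2_of_SR2)

/-- The probability `𝔬` that `S → D` fails when the candidate set is `{S,R1,R2}`. -/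
def probO (ρ : Measure Slot) (Γ : ℝ) : ℝ :=
  (ρ[|tcAll]).real (fails Γ .S_of_SR1R2)

/-- The probability `𝔣` that `R2 → D` fails when the candidate set is `{S,R1,R2}` (and `S → D`
fails). -/
def probF (ρ : Measure Slot) (Γ : ℝ) : ℝ :=
  (ρ[|tcAll ∩ fails Γ .S_of_SR1R2]).real (fails Γ .R2_of_SR1R2)

/-- The discharge probability `b₂`. -/
def dischargeProb (ρ : Measure Slot) (Γ : ℝ) : ℝ :=
  probTC ρ .SR2 * probM ρ Γ * (1 - probN ρ Γ) +
    (probTC ρ .SR1R2₁ + probTC ρ .SR1R2₂ + probTC ρ .SR1R2₃) * probO ρ Γ * (1 - probF ρ Γ)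

theorem measurableSet_tcIs (c : TCState) : MeasurableSet (tcIs c) :=
  measurable_fst (MeasurableSpace.measurableSet_top (s := {c}))

theorem measurableSet_fails (Γ : ℝ) (a : Attempt) : MeasurableSet (fails Γ a) :=
  measurableSet_lt ((measurable_pi_apply a).comp measurable_snd) measurable_const

theorem cond_real_mul_one_sub (ρ : Measure Slot) [IsProbabilityMeasure ρ] {A F G : Set Slot}
    (hA : MeasurableSet A) (hF : MeasurableSet F)
    (h : (ρ[|A]).real (F ∩ G) = (ρ[|A]).real F * (ρ[|A]).real G) :
    (ρ[|A]).real F * (1 - (ρ[|A ∩ F]).real G) = (ρ[|A]).real F * (1 - (ρ[|A]).real G) := by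
  rcases eq_or_ne ((ρ[|A]).real F) 0 with h0 | h0
  · simp [h0]
  · have h1 : (ρ[|A ∩ F]).real G = (ρ[|A]).real G := by
      rw [← cond_cond_eq_cond_inter hA hF, measureReal_def, cond_apply hF, ENNReal.toReal_mul,
        ENNReal.toReal_inv, ← measureReal_def, ← measureReal_def, h, inv_mul_cancel_left₀ h0]
    rw [h1]

/-- If, given the candidate set, the failures of `S → D` and of `R2 → D` are independent, then
`𝔫` and `𝔣` in the formula for `b₂` are the plain failure probabilities of `R2 → D`. -/
theorem dischargeProb_of_indep (ρ : Measure Slot) [IsProbabilityMeasure ρ] (Γ : ℝ)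
    (h₂ : (ρ[|tcIs .SR2]).real (fails Γ .S_of_SR2 ∩ fails Γ .R2_of_SR2) =
      (ρ[|tcIs .SR2]).real (fails Γ .S_of_SR2) * (ρ[|tcIs .SR2]).real (fails Γ .R2_of_SR2))
    (h₃ : (ρ[|tcAll]).real (fails Γ .S_of_SR1R2 ∩ fails Γ .R2_of_SR1R2) =
      (ρ[|tcAll]).real (fails Γ .S_of_SR1R2) * (ρ[|tcAll]).real (fails Γ .R2_of_SR1R2)) :
    dischargeProb ρ Γ =
      probTC ρ .SR2 * probM ρ Γ * (1 - (ρ[|tcIs .SR2]).real (fails Γ .R2_of_SR2)) +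
      (probTC ρ .SR1R2₁ + probTC ρ .SR1R2₂ + probTC ρ .SR1R2₃) * probO ρ Γ *
        (1 - (ρ[|tcAll]).real (fails Γ .R2_of_SR1R2)) := by
  have hAll : MeasurableSet tcAll :=
    ((measurableSet_tcIs _).union (measurableSet_tcIs _)).union (measurableSet_tcIs _)
  have e₂ := cond_real_mul_one_sub ρ (measurableSet_tcIs _) (measurableSet_fails Γ _) h₂
  have e₃ := cond_real_mul_one_sub ρ hAll (measurableSet_fails Γ _) h₃
  simp only [dischargeProb, probM, probN, probO, probF, mul_assoc, e₂, e₃]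

open Classical in
/-- One step of the energy buffer of `R2`: the buffer level is `x`, the slot is `s`, and the
energy `e` is harvested. -/
def bufferStep (M Γ x : ℝ) (s : Slot) (e : ℝ) : ℝ :=
  if M ≤ x ∧ s ∈ dischargeSlots Γ then x - M + e else x + e

/-- `B` is an energy-buffer process: the slots `T i` are i.i.d. with law `ρ`, the harvested energies
`X i` are i.i.d. exponential with rate `lam`, the initial level `B 0` is nonnegative, all
of these are independent, and `B` follows the update equation. -/
structure IsBufferProcess {Ω : Type*} [MeasurableSpace Ω] (P : Measure Ω)
    (lam M Γ : ℝ) (ρ : Measure Slot)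
    (X : ℕ → Ω → ℝ) (T : ℕ → Ω → Slot) (B : ℕ → Ω → ℝ) : Prop where
  measurable_harvest : ∀ i, Measurable (X i)
  measurable_slot : ∀ i, Measurable (T i)
  measurable_init : Measurable (B 0)
  law_harvest : ∀ i, P.map (X i) = expMeasure lam
  law_slot : ∀ i, P.map (T i) = ρ
  indep_harvest_slot : ∀ i, IndepFun (X i) (T i) P
  indep_time : iIndepFun (fun i ω ↦ (X i ω, T i ω)) P
  indep_init : IndepFun (B 0) (fun ω i ↦ (X i ω, T i ω)) P
  init_nonneg : ∀ᵐ ω ∂P, 0 ≤ B 0 ω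
  update : ∀ i ω, B (i + 1) ω = bufferStep M Γ (B i ω) (T i ω) (X i ω)

/-- The law `ν` of the buffer level is stationary: if the level has law `ν` and an independent slot
and an independent harvested energy are drawn, then the next level again has law `ν`. -/
def IsStationaryLaw (lam M Γ : ℝ) (ρ : Measure Slot) (ν : Measure ℝ) : Prop :=
  (ν.prod (ρ.prod (expMeasure lam))).map (fun z ↦ bufferStep M Γ z.1 z.2.1 z.2.2) = ν

/-- The principal branch of the Lambert W function: for `y ≥ -1/e`, the unique `w ≥ -1` with
`w * exp w = y`. -/
def lambertW (y : ℝ) : ℝ :=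
  Function.invFunOn (fun w : ℝ ↦ w * Real.exp w) (Set.Ici (-1)) y

/-- The exponent `Q₂`. -/
def decayRate (b lam M : ℝ) : ℝ :=
  -lambertW (-(b * lam * M) * Real.exp (-(b * lam * M))) / M - b * lam

/-- The density `g₂`, with the value `0` for negative energies. -/
def limitDensity (b lam M Q x : ℝ) : ℝ :=
  if x < 0 then 0
  else if x < M then 1 / M * (1 - Real.exp (Q * x))
  else 1 / M * (-Q * Real.exp (Q * x) / (b * lam + Q))

/-- The measure on `ℝ` with density `g₂`. -/
def limitLaw (b lam M Q : ℝ) : Measure ℝ :=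
  volume.withDensity fun x ↦ ENNReal.ofReal (limitDensity b lam M Q x)

end

/-! The slot law enters only through `b`, the probability of `dischargeSlots`. The level is thus a
Markov chain: from a level at least `M` it drops by `M` with probability `b`, and then an
independent exponential harvest is added.

Stationarity. Let `g` be the limiting density and `k` the density after a possible discharge. It
suffices that `k` convolved with the exponential law gives back `g`, that is, `g' + λ g = λ k` with
`g 0 = 0`. Above `M` this reads `g' x = λ b (g (x + M) - g x)`, solved by `exp (Q x)` exactly when
`b λ exp (Q M) = b λ + Q`. On `(0, M)` it reads `g' x = λ b g (x + M)`, which integrates to a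
multiple of `1 - exp (Q x)`. A negative root `Q` exists because the mean discharge `b M` exceeds the
mean harvest `1 / λ`. See `hasDerivAt_limitDensity_mul_exp` and `isStationaryLaw_limitLaw`.

Convergence and uniqueness. Harris' theorem, `tendsto_iterate_bind_apply`, is applied with the
Lyapunov function `exp (s x)`, `s = -Q / 2`. The moment generating function of the increment above
`M` equals `1` at `0` and at `-Q`, so by convexity it is below `1` in between; this is the drift.
Bounded levels form a small set because the exponential harvest spreads them over a common
half-line. Uniqueness follows since a second stationary law, used as initial law, must converge to
the first. -/

/-! ### Harris' theorem by contraction of a weighted oscillation. -/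

/-- A function whose differences are dominated by a sum lies in a tube around a constant. -/
theorem exists_abs_sub_le_of_abs_sub_le_add {E : Type*} [Nonempty E] {φ w : E → ℝ}
    (h : ∀ x y, |φ x - φ y| ≤ w x + w y) : ∃ c, ∀ x, |φ x - c| ≤ w x := by
  have key : ∀ x y, φ x - w x ≤ φ y + w y := fun x y ↦ by
    have := (abs_le.1 (h x y)).2
    linarith
  have hbdd : ∀ y, BddAbove (Set.range fun x ↦ φ x - w x) := fun y ↦
    ⟨φ y + w y, by rintro _ ⟨x, rfl⟩; exact key x y⟩
  -- By `key`, every lower envelope value `φ x - w x` is below every upper one, so their supremum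
  -- fits in between.
  refine ⟨⨆ x, (φ x - w x), fun x ↦ abs_le.2 ⟨?_, ?_⟩⟩
  · have := ciSup_le fun y ↦ key y x
    linarith
  · have := le_ciSup (hbdd x) x
    linarith

/-- Two probability measures with a common part `η` integrate a function in a tube around a constant
to values whose distance sees only the rest of the two measures. -/
theorem abs_integral_sub_integral_le_of_le {E : Type*} [MeasurableSpace E]
    {μ₁ μ₂ η : Measure E} [IsProbabilityMeasure μ₁] [IsProbabilityMeasure μ₂] [IsFiniteMeasure η]
    (h₁ : η ≤ μ₁) (h₂ : η ≤ μ₂) {φ w : E → ℝ} {c : ℝ}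
    (hφ₁ : Integrable φ μ₁) (hφ₂ : Integrable φ μ₂)
    (hw₁ : Integrable w μ₁) (hw₂ : Integrable w μ₂) (hφ : ∀ x, |φ x - c| ≤ w x) :
    |∫ x, φ x ∂μ₁ - ∫ x, φ x ∂μ₂| ≤ ∫ x, w x ∂μ₁ + ∫ x, w x ∂μ₂ - 2 * ∫ x, w x ∂η := by
  -- Subtracting the two instances cancels both `c` and the integral of `φ - c` over `η`, which are
  -- the same for `μ₁` and `μ₂`.
  have aux : ∀ μ : Measure E, IsProbabilityMeasure μ → η ≤ μ → Integrable φ μ → Integrable w μ →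
      |∫ x, φ x ∂μ - c - ∫ x, (φ x - c) ∂η| ≤ ∫ x, w x ∂μ - ∫ x, w x ∂η := by
    intro μ _ hle hi hw
    have hsum : μ - η + η = μ := Measure.sub_add_cancel_of_le hle
    have hd : Integrable (fun x ↦ φ x - c) μ := hi.sub (integrable_const c)
    have e₁ : ∫ x, φ x ∂μ - c = ∫ x, (φ x - c) ∂(μ - η) + ∫ x, (φ x - c) ∂η := by
      rw [← integral_add_measure (hd.mono_measure Measure.sub_le) (hd.mono_measure hle), hsum,
        integral_sub hi (integrable_const c)]
      simp
    have e₂ : ∫ x, w x ∂μ = ∫ x, w x ∂(μ - η) + ∫ x, w x ∂η := by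
      rw [← integral_add_measure (hw.mono_measure Measure.sub_le) (hw.mono_measure hle), hsum]
    rw [e₁, e₂, add_sub_cancel_right, add_sub_cancel_right]
    exact norm_integral_le_of_norm_le (hw.mono_measure Measure.sub_le)
      (Eventually.of_forall fun x ↦ (Real.norm_eq_abs _).trans_le (hφ x))
  have a₁ := abs_le.1 (aux μ₁ inferInstance h₁ hφ₁ hw₁)
  have a₂ := abs_le.1 (aux μ₂ inferInstance h₂ hφ₂ hw₂)
  exact abs_le.2 ⟨by linarith [a₁.1, a₂.2], by linarith [a₁.2, a₂.1]⟩

noncomputable section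

/-- The action of a Markov kernel on functions. -/
def kernelAction {E : Type*} [MeasurableSpace E] (K : Kernel E E) (φ : E → ℝ) (x : E) : ℝ :=
  ∫ y, φ y ∂K x

end

section Harris

variable {E : Type*} [MeasurableSpace E] {K : Kernel E E}

theorem measurable_kernelAction {φ : E → ℝ} (hφ : Measurable φ) :
    Measurable (kernelAction K φ) :=
  (hφ.stronglyMeasurable.integral_kernel (κ := K)).measurable

theorem integrable_of_measurable_of_abs_le (μ : Measure E) [IsFiniteMeasure μ] {φ : E → ℝ} {C : ℝ}
    (hφ : Measurable φ) (hC : ∀ x, |φ x| ≤ C) : Integrable φ μ :=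
  Integrable.of_bound hφ.aestronglyMeasurable C (Eventually.of_forall hC)

theorem measurable_iterate_kernelAction {φ : E → ℝ} (hφ : Measurable φ) (n : ℕ) :
    Measurable ((kernelAction K)^[n] φ) := by
  induction n with
  | zero => exact hφ
  | succ n ih =>
    rw [Function.iterate_succ_apply']
    exact measurable_kernelAction ih

variable [IsMarkovKernel K]

theorem abs_kernelAction_le {φ : E → ℝ} {C : ℝ} (hC : ∀ x, |φ x| ≤ C) (x : E) :
    |kernelAction K φ x| ≤ C := by
  simpa [kernelAction] using
    norm_integral_le_of_norm_le_const (μ := K x) (f := φ) (Eventually.of_forall hC)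

theorem abs_iterate_kernelAction_le {φ : E → ℝ} {C : ℝ} (hC : ∀ x, |φ x| ≤ C) (n : ℕ) (x : E) :
    |(kernelAction K)^[n] φ x| ≤ C := by
  induction n generalizing x with
  | zero => exact hC x
  | succ n ih =>
    rw [Function.iterate_succ_apply']
    exact abs_kernelAction_le ih x

/-- One step of a kernel with a drift towards a small set contracts a weighted oscillation. -/
theorem exists_oscillation_contraction [Nonempty E] {V : E → ℝ} (hV : ∀ x, 0 ≤ V x)
    (hVint : ∀ x, Integrable V (K x)) {γ C : ℝ} (hγ₀ : 0 ≤ γ) (hγ : γ < 1) (hC : 0 ≤ C)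
    (hdrift : ∀ x, ∫ y, V y ∂K x ≤ γ * V x + C)
    (hsmall : ∀ R, ∃ η : Measure E, IsFiniteMeasure η ∧ η ≠ 0 ∧ ∀ x, V x ≤ R → η ≤ K x) :
    ∃ α β : ℝ, 0 ≤ α ∧ α < 1 ∧ 0 < β ∧ ∀ (φ : E → ℝ) (t : ℝ), 0 ≤ t → (∀ x, Integrable φ (K x)) →
      (∃ c, ∀ x, |φ x - c| ≤ t * (1 + β * V x)) →
      ∃ c, ∀ x, |kernelAction K φ x - c| ≤ α * t * (1 + β * V x) := by
  -- The constants make both cases below end at `2 * (1 - β) + γ' * β * (V x + V y)`: `R` gives `(γ'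
  -- - γ) * R = 2 * C + 2`, and `β` gives `β * (C + 1) = a / 2`, with `a` the mass of the common
  -- part.
  set γ' := (1 + γ) / 2 with hγ'
  set R := (2 * C + 2) / (γ' - γ) with hR
  have hγγ' : 0 < γ' - γ := by rw [hγ']; linarith
  have hRmul : (γ' - γ) * R = 2 * C + 2 := by rw [hR]; field_simp
  obtain ⟨η, hη, hη₀, hηle⟩ := hsmall R
  set a := η.real Set.univ with ha_def
  have ha : 0 < a := by
    have : NeZero η := ⟨hη₀⟩
    exact measureReal_univ_pos
  set β := a / (2 * (C + 1)) with hβ_def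
  have hβ : 0 < β := by positivity
  have hβmul : β * C + β = a / 2 := by rw [hβ_def]; field_simp
  have hβC : 0 ≤ β * C := by positivity
  refine ⟨max (1 - β) γ', β, le_max_of_le_right (by linarith), max_lt (by linarith) (by linarith),
    hβ, fun φ t ht hφ ⟨c, hc⟩ ↦ ?_⟩
  set α := max (1 - β) γ'
  have hα₁ : 1 - β ≤ α := le_max_left _ _
  have hα₂ : γ' ≤ α := le_max_right _ _
  have hw : ∀ x, Integrable (fun y ↦ t * (1 + β * V y)) (K x) := fun x ↦
    ((integrable_const _).add ((hVint x).const_mul β)).const_mul t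
  have hwle : ∀ x, ∫ y, t * (1 + β * V y) ∂K x ≤ t * (1 + β * (γ * V x + C)) := fun x ↦ by
    rw [integral_const_mul, integral_add (integrable_const _) ((hVint x).const_mul β),
      integral_const_mul]
    simp only [integral_const, probReal_univ, smul_eq_mul, mul_one]
    gcongr
    exact hdrift x
  have key : ∀ x y, |kernelAction K φ x - kernelAction K φ y| ≤
      α * t * (1 + β * V x) + α * t * (1 + β * V y) := by
    intro x y
    have hx := hwle x
    have hy := hwle y
    have hW : 0 ≤ V x + V y := add_nonneg (hV x) (hV y)
    have hαW : γ' * (β * (V x + V y)) ≤ α * (β * (V x + V y)) := by gcongr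
    have suff : ∀ B : ℝ, B ≤ α * (2 + β * (V x + V y)) →
        |kernelAction K φ x - kernelAction K φ y| ≤ t * B →
        |kernelAction K φ x - kernelAction K φ y| ≤
          α * t * (1 + β * V x) + α * t * (1 + β * V y) := fun B hB h ↦
      h.trans ((mul_le_mul_of_nonneg_left hB ht).trans_eq (by ring))
    -- If both points lie in the small set, the common part gains `2 * a`, which pays for the drift
    -- constant.
    rcases le_total (V x + V y) R with hle | hge
    · have h := abs_integral_sub_integral_le_of_le (hηle x (by linarith [hV y]))
        (hηle y (by linarith [hV x])) (hφ x) (hφ y) (hw x) (hw y) hc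
      have hη_int : t * a ≤ ∫ z, t * (1 + β * V z) ∂η := by
        have h₁ : ∫ _, t ∂η ≤ ∫ z, t * (1 + β * V z) ∂η := by
          refine integral_mono (integrable_const t)
            ((hw x).mono_measure (hηle x (by linarith [hV y]))) fun z ↦ ?_
          have := mul_nonneg ht (mul_nonneg hβ.le (hV z))
          simp only
          linarith
        rwa [integral_const, smul_eq_mul, mul_comm, ← ha_def] at h₁
      refine suff (2 + β * γ * (V x + V y) + 2 * (β * C) - 2 * a) ?_ (h.trans ?_)
      · have : β * γ * (V x + V y) ≤ γ' * (β * (V x + V y)) := by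
          have := mul_nonneg hγγ'.le (mul_nonneg hβ.le hW)
          linarith
        linarith
      · linarith
    -- Far out no common part is needed: the gap between `γ` and `γ'` beats the drift constant.
    · have h := abs_integral_sub_integral_le_of_le (η := 0) (Measure.zero_le _)
        (Measure.zero_le _) (hφ x) (hφ y) (hw x) (hw y) hc
      rw [integral_zero_measure, mul_zero, sub_zero] at h
      refine suff (2 + β * γ * (V x + V y) + 2 * (β * C)) ?_ (h.trans ?_)
      · have h₁ : β * ((γ' - γ) * R) ≤ β * ((γ' - γ) * (V x + V y)) := by gcongr
        rw [hRmul] at h₁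
        linarith
      · linarith
  exact exists_abs_sub_le_of_abs_sub_le_add key

/-- The contraction is iterated from the tube of centre `0` and width `1 + β * V`, which contains
`φ`; in the difference at `x` and `y` the unknown centres cancel. -/
theorem tendsto_iterate_kernelAction_sub [Nonempty E] {V : E → ℝ} (hV : ∀ x, 0 ≤ V x)
    (hVint : ∀ x, Integrable V (K x)) {γ C : ℝ} (hγ₀ : 0 ≤ γ) (hγ : γ < 1) (hC : 0 ≤ C)
    (hdrift : ∀ x, ∫ y, V y ∂K x ≤ γ * V x + C)
    (hsmall : ∀ R, ∃ η : Measure E, IsFiniteMeasure η ∧ η ≠ 0 ∧ ∀ x, V x ≤ R → η ≤ K x)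
    {φ : E → ℝ} (hφ : Measurable φ) (hφ₁ : ∀ x, |φ x| ≤ 1) (x y : E) :
    Tendsto (fun n ↦ (kernelAction K)^[n] φ x - (kernelAction K)^[n] φ y) atTop (𝓝 0) := by
  obtain ⟨α, β, hα₀, hα, hβ, h⟩ :=
    exists_oscillation_contraction hV hVint hγ₀ hγ hC hdrift hsmall
  have hosc : ∀ n, ∃ c, ∀ x, |(kernelAction K)^[n] φ x - c| ≤ α ^ n * (1 + β * V x) := by
    intro n
    induction n with
    | zero =>
      refine ⟨0, fun x ↦ ?_⟩
      have := mul_nonneg hβ.le (hV x)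
      simpa using (hφ₁ x).trans (by linarith)
    | succ n ih =>
      rw [Function.iterate_succ_apply', pow_succ']
      exact h _ _ (pow_nonneg hα₀ n) (fun x ↦ integrable_of_measurable_of_abs_le _
        (measurable_iterate_kernelAction hφ n) (abs_iterate_kernelAction_le hφ₁ n)) ih
  refine squeeze_zero_norm (a := fun n ↦ α ^ n * (2 + β * V x + β * V y)) (fun n ↦ ?_) ?_
  · obtain ⟨c, hc⟩ := hosc n
    have hx := abs_le.1 (hc x)
    have hy := abs_le.1 (hc y)
    rw [Real.norm_eq_abs]
    exact abs_le.2 ⟨by linarith [hx.1, hy.2], by linarith [hx.2, hy.1]⟩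
  · simpa using (tendsto_pow_atTop_nhds_zero_of_lt_one hα₀ hα).mul_const
      (2 + β * V x + β * V y)

theorem integral_bind_kernel (ν : Measure E) [IsFiniteMeasure ν] {φ : E → ℝ} {C : ℝ}
    (hφ : Measurable φ) (hC : ∀ x, |φ x| ≤ C) :
    ∫ x, φ x ∂(ν.bind K) = ∫ x, kernelAction K φ x ∂ν := by
  have h := Kernel.integral_comp (κ := Kernel.const Unit ν) (η := K) (a := ()) (f := φ)
    (integrable_of_measurable_of_abs_le _ hφ hC)
  simpa [Kernel.comp_apply, kernelAction] using h

/-- Harris' theorem: under a drift condition towards small sets, the laws of the chain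
converge setwise to an invariant law. -/
theorem tendsto_iterate_bind_apply [Nonempty E] {V : E → ℝ} (hV : ∀ x, 0 ≤ V x)
    (hVint : ∀ x, Integrable V (K x)) {γ C : ℝ} (hγ₀ : 0 ≤ γ) (hγ : γ < 1) (hC : 0 ≤ C)
    (hdrift : ∀ x, ∫ y, V y ∂K x ≤ γ * V x + C)
    (hsmall : ∀ R, ∃ η : Measure E, IsFiniteMeasure η ∧ η ≠ 0 ∧ ∀ x, V x ≤ R → η ≤ K x)
    {π : Measure E} [IsProbabilityMeasure π] (hπ : π.bind K = π)
    {ν : ℕ → Measure E} (hν₀ : IsProbabilityMeasure (ν 0)) (hν : ∀ n, ν (n + 1) = (ν n).bind K)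
    {A : Set E} (hA : MeasurableSet A) :
    Tendsto (fun n ↦ ν n A) atTop (𝓝 (π A)) := by
  have hprob : ∀ n, IsProbabilityMeasure (ν n) := by
    intro n
    induction n with
    | zero => exact hν₀
    | succ n ih => rw [hν n]; infer_instance
  have iter : ∀ μ : ℕ → Measure E, (∀ n, IsProbabilityMeasure (μ n)) →
      (∀ n, μ (n + 1) = (μ n).bind K) → ∀ n φ, Measurable φ → (∀ x, |φ x| ≤ 1) →
      ∫ x, φ x ∂μ n = ∫ x, (kernelAction K)^[n] φ x ∂μ 0 := by
    intro μ hμ hstep n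
    induction n with
    | zero => intros; rfl
    | succ n ih =>
      intro φ hφ hφ₁
      have := hμ n
      rw [hstep n, integral_bind_kernel _ hφ hφ₁,
        ih _ (measurable_kernelAction hφ) (abs_kernelAction_le hφ₁), Function.iterate_succ_apply]
  set φ : E → ℝ := A.indicator 1 with hφ_def
  have hφ : Measurable φ := measurable_one.indicator hA
  have hφ₁ : ∀ x, |φ x| ≤ 1 := fun x ↦ by
    by_cases hx : x ∈ A <;> simp [hφ_def, hx]
  -- Comparison with one fixed point treats `ν 0` and `π` separately. Dominated convergence with
  -- bound `2` then replaces any integrability of `V` under these laws.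
  let o : E := Classical.arbitrary E
  have lim : ∀ μ : Measure E, IsProbabilityMeasure μ →
      Tendsto (fun n ↦ ∫ x, (kernelAction K)^[n] φ x ∂μ - (kernelAction K)^[n] φ o) atTop
        (𝓝 0) := by
    intro μ _
    have e : ∀ n, ∫ x, (kernelAction K)^[n] φ x ∂μ - (kernelAction K)^[n] φ o =
        ∫ x, ((kernelAction K)^[n] φ x - (kernelAction K)^[n] φ o) ∂μ := fun n ↦ by
      rw [integral_sub (integrable_of_measurable_of_abs_le _
        (measurable_iterate_kernelAction hφ n) (abs_iterate_kernelAction_le hφ₁ n))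
        (integrable_const _)]
      simp
    simp_rw [e]
    rw [← integral_zero E ℝ (μ := μ)]
    refine tendsto_integral_of_dominated_convergence (fun _ ↦ 2) (fun n ↦
      ((measurable_iterate_kernelAction hφ n).sub_const _).aestronglyMeasurable)
      (integrable_const _) (fun n ↦ Eventually.of_forall fun x ↦ ?_)
      (Eventually.of_forall fun x ↦
        tendsto_iterate_kernelAction_sub hV hVint hγ₀ hγ hC hdrift hsmall hφ hφ₁ x o)
    have h₁ := abs_le.1 (abs_iterate_kernelAction_le (K := K) hφ₁ n x)
    have h₂ := abs_le.1 (abs_iterate_kernelAction_le (K := K) hφ₁ n o)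
    exact abs_le.2 ⟨by linarith [h₁.1, h₂.2], by linarith [h₁.2, h₂.1]⟩
  have hreal : ∀ μ : Measure E, ∫ x, φ x ∂μ = μ.real A := fun μ ↦ integral_indicator_one hA
  have hlim := (lim (ν 0) hν₀).sub (lim π inferInstance)
  have e : ∀ n, ∫ x, (kernelAction K)^[n] φ x ∂ν 0 - (kernelAction K)^[n] φ o -
      (∫ x, (kernelAction K)^[n] φ x ∂π - (kernelAction K)^[n] φ o) =
      (ν n).real A - π.real A := fun n ↦ by
    rw [← iter ν hprob hν n φ hφ hφ₁,
      ← iter (fun _ ↦ π) (fun _ ↦ inferInstance) (fun _ ↦ hπ.symm) n φ hφ hφ₁, hreal, hreal]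
    ring
  simp_rw [e, sub_zero] at hlim
  have hlim' := hlim.add_const (π.real A)
  simp only [sub_add_cancel, zero_add] at hlim'
  exact (ENNReal.tendsto_toReal_iff (fun n ↦ measure_ne_top _ _) (measure_ne_top _ _)).1 hlim'

end Harris

/-! ### The discharge probability as the measure of one event. -/

section DischargeProbability

theorem measurableSet_tcAll : MeasurableSet tcAll :=
  ((measurableSet_tcIs _).union (measurableSet_tcIs _)).union (measurableSet_tcIs _)

theorem measurableSet_dischargeSlots (Γ : ℝ) : MeasurableSet (dischargeSlots Γ) :=
  (((measurableSet_tcIs _).inter (measurableSet_fails Γ _)).inter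
    (measurableSet_fails Γ _).compl).union
    ((measurableSet_tcAll.inter (measurableSet_fails Γ _)).inter (measurableSet_fails Γ _).compl)

theorem disjoint_tcIs {c d : TCState} (h : c ≠ d) : Disjoint (tcIs c) (tcIs d) :=
  Set.disjoint_left.2 fun _ hc hd ↦ h (hc.symm.trans hd)

/-- The chain rule for conditional probabilities. Null conditioning events do no harm, since a
vanishing factor stands in front of them. -/
theorem real_mul_cond_real_mul_one_sub_cond_real (ρ : Measure Slot) [IsProbabilityMeasure ρ]
    {A F G : Set Slot} (hA : MeasurableSet A) (hF : MeasurableSet F) (hG : MeasurableSet G) :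
    ρ.real A * (ρ[|A]).real F * (1 - (ρ[|A ∩ F]).real G) = ρ.real (A ∩ F ∩ Gᶜ) := by
  have h : ∀ {B : Set Slot} (C : Set Slot), MeasurableSet B →
      ρ.real B * (ρ[|B]).real C = ρ.real (B ∩ C) := fun C hB ↦ by
    rw [measureReal_def, measureReal_def, measureReal_def, ← cond_mul_eq_inter hB C ρ,
      ENNReal.toReal_mul, mul_comm]
  rw [h F hA, mul_sub, mul_one, h G (hA.inter hF), ← Set.sdiff_eq, sub_eq_iff_eq_add', add_comm,
    measureReal_sdiff_add_inter hG]

theorem real_tcAll (ρ : Measure Slot) [IsProbabilityMeasure ρ] :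
    ρ.real tcAll = probTC ρ .SR1R2₁ + probTC ρ .SR1R2₂ + probTC ρ .SR1R2₃ := by
  rw [tcAll, measureReal_union _ (measurableSet_tcIs _), measureReal_union _ (measurableSet_tcIs _)]
  · rfl
  · exact disjoint_tcIs (by simp)
  · exact (disjoint_tcIs (by simp)).union_left (disjoint_tcIs (by simp))

theorem dischargeProb_eq_real_dischargeSlots (ρ : Measure Slot) [IsProbabilityMeasure ρ] (Γ : ℝ) :
    dischargeProb ρ Γ = ρ.real (dischargeSlots Γ) := by
  have hdisj : Disjoint (tcIs .SR2) tcAll :=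
    ((disjoint_tcIs (by simp)).union_right (disjoint_tcIs (by simp))).union_right
      (disjoint_tcIs (by simp))
  rw [dischargeSlots, measureReal_union
    (hdisj.mono (fun _ h ↦ h.1.1) (fun _ h ↦ h.1.1))
    ((measurableSet_tcAll.inter (measurableSet_fails Γ _)).inter (measurableSet_fails Γ _).compl),
    ← real_mul_cond_real_mul_one_sub_cond_real ρ (measurableSet_tcIs _)
      (measurableSet_fails Γ _) (measurableSet_fails Γ _),
    ← real_mul_cond_real_mul_one_sub_cond_real ρ measurableSet_tcAll
      (measurableSet_fails Γ _) (measurableSet_fails Γ _), real_tcAll]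
  rfl

end DischargeProbability

/-! ### The Lambert function and the exponent. -/

section Exponent

theorem lambertW_spec {y : ℝ} (h : ∃ w ∈ Set.Ici (-1 : ℝ), w * Real.exp w = y) :
    -1 ≤ lambertW y ∧ lambertW y * Real.exp (lambertW y) = y :=
  ⟨Function.invFunOn_mem h, Function.invFunOn_eq h⟩

/-- On `[-1, 0]` the function `w * exp w` runs from `-1/e` to `0`, and `β ≤ exp (β - 1)` places the
target in this range. -/
theorem exists_mul_exp_eq_neg_mul_exp_neg {β : ℝ} (hβ : 0 ≤ β) :
    ∃ w ∈ Set.Ici (-1 : ℝ), w * Real.exp w = -β * Real.exp (-β) := by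
  have hcont : ContinuousOn (fun w : ℝ ↦ w * Real.exp w) (Set.Icc (-1) 0) := by fun_prop
  have hmem : -β * Real.exp (-β) ∈ Set.Icc (-1 * Real.exp (-1)) (0 * Real.exp 0) := by
    constructor
    · have h := Real.add_one_le_exp (β - 1)
      have h' : β * Real.exp (-β) ≤ Real.exp (β - 1) * Real.exp (-β) := by
        gcongr
        linarith
      rw [← Real.exp_add, show β - 1 + -β = -1 by ring] at h'
      linarith
    · have := mul_nonneg hβ (Real.exp_pos (-β)).le
      linarith
  obtain ⟨w, hw, hwe⟩ := intermediate_value_Icc (by norm_num) hcont hmem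
  exact ⟨w, hw.1, hwe⟩

/-- With `β = b * lam * M > 1` and `w` the value of the principal branch, `Q * M = -w - β`. It is
negative because `w ≥ -1 > -β`, and `w * exp w = -β * exp (-β)` rearranges to `-w = β * exp (Q *
M)`. -/
theorem decayRate_spec {b lam M : ℝ} (hM : 0 < M) (hψ : 1 < b * lam * M) :
    decayRate b lam M < 0 ∧
      b * lam * Real.exp (decayRate b lam M * M) = b * lam + decayRate b lam M := by
  set β := b * lam * M with hβ
  obtain ⟨h₁, h₂⟩ := lambertW_spec (exists_mul_exp_eq_neg_mul_exp_neg (β := β) (by linarith))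
  set w := lambertW (-β * Real.exp (-β)) with hw
  have hQ : decayRate b lam M = -w / M - b * lam := by rw [decayRate, ← hβ, ← hw]
  have hQM : decayRate b lam M * M = -w - β := by rw [hQ, hβ]; field_simp
  constructor
  · refine neg_of_mul_neg_left (b := M) ?_ hM.le
    linarith
  · refine mul_right_cancel₀ hM.ne' ?_
    have e : (b * lam + decayRate b lam M) * M = -w := by rw [add_mul, hQM, hβ]; ring
    have h₃ : w = -β * Real.exp (-w - β) := by
      rw [sub_eq_add_neg, add_comm, Real.exp_add, ← mul_assoc, ← h₂, mul_assoc, ← Real.exp_add]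
      simp
    rw [e, hQM, mul_right_comm, ← hβ]
    linarith

/-- Every nonzero root `p` gives the secant of `exp` from `0` to `p * M` the same slope `1 / (c *
M)`, while strict convexity makes these slopes strictly increasing. -/
theorem eq_of_mul_exp_eq {c M q r : ℝ} (hc : 0 < c) (hM : 0 < M) (hq₀ : q ≠ 0) (hr₀ : r ≠ 0)
    (hq : c * Real.exp (q * M) = c + q) (hr : c * Real.exp (r * M) = c + r) : q = r := by
  have slope : ∀ {p : ℝ}, p ≠ 0 → c * Real.exp (p * M) = c + p →
      (Real.exp (p * M) - Real.exp 0) / (p * M - 0) = 1 / (c * M) := fun {p} hp₀ hp ↦ by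
    have : Real.exp (p * M) - Real.exp 0 = p / c := by
      rw [Real.exp_zero, eq_div_iff hc.ne']
      linarith
    rw [this, sub_zero]
    field_simp
  have no_lt : ∀ {p s : ℝ}, p ≠ 0 → s ≠ 0 → c * Real.exp (p * M) = c + p →
      c * Real.exp (s * M) = c + s → ¬ p < s := fun {p s} hp₀ hs₀ hp hs hlt ↦ by
    have h := strictConvexOn_exp.secant_strict_mono (Set.mem_univ 0) (Set.mem_univ (p * M))
      (Set.mem_univ (s * M)) (mul_ne_zero hp₀ hM.ne') (mul_ne_zero hs₀ hM.ne')
      (mul_lt_mul_of_pos_right hlt hM)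
    rw [slope hp₀ hp, slope hs₀ hs] at h
    exact lt_irrefl _ h
  exact le_antisymm (not_lt.1 (no_lt hr₀ hq₀ hr hq)) (not_lt.1 (no_lt hq₀ hr₀ hq hr))

end Exponent

/-! ### Random maps as Markov kernels. -/

noncomputable section

/-- The Markov kernel of the random map `x ↦ f (x, s)`, where `s` has law `μ`. -/
def randomMapKernel {E S : Type*} [MeasurableSpace E] [MeasurableSpace S] (μ : Measure S)
    [SFinite μ] (f : E × S → E) (hf : Measurable f) : Kernel E E where
  toFun x := μ.map fun s ↦ f (x, s)
  measurable' := by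
    refine Measure.measurable_of_measurable_coe _ fun A hA ↦ ?_
    have : ∀ x, μ.map (fun s ↦ f (x, s)) A = μ (Prod.mk x ⁻¹' (f ⁻¹' A)) := fun x ↦
      Measure.map_apply (hf.comp measurable_prodMk_left) hA
    simp_rw [this]
    exact measurable_measure_prodMk_left (hf hA)

open Classical in
/-- The buffer level after a possible discharge and before harvesting. -/
def levelAfterDischarge (M Γ x : ℝ) (s : Slot) : ℝ :=
  if M ≤ x ∧ s ∈ dischargeSlots Γ then x - M else x

end

section RandomMap

variable {E S : Type*} [MeasurableSpace E] [MeasurableSpace S] {μ : Measure S} {f : E × S → E}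

theorem randomMapKernel_apply [SFinite μ] (hf : Measurable f) (x : E) :
    randomMapKernel μ f hf x = μ.map (f ∘ Prod.mk x) := rfl

instance isMarkovKernel_randomMapKernel [IsProbabilityMeasure μ] (hf : Measurable f) :
    IsMarkovKernel (randomMapKernel μ f hf) :=
  ⟨fun _ ↦ Measure.isProbabilityMeasure_map (hf.comp measurable_prodMk_left).aemeasurable⟩

theorem bind_randomMapKernel [SFinite μ] (hf : Measurable f) (ν : Measure E) :
    ν.bind (randomMapKernel μ f hf) = (ν.prod μ).map f := by
  ext A hA
  rw [Measure.bind_apply hA (Kernel.aemeasurable _), Measure.map_apply hf hA,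
    Measure.prod_apply (hf hA)]
  refine lintegral_congr fun x ↦ ?_
  rw [randomMapKernel_apply, Measure.map_apply (hf.comp measurable_prodMk_left) hA]
  rfl

end RandomMap

/-! ### The exponential law: moments and minorization. -/

section Exponential

theorem expMeasure_eq_withDensity (r : ℝ) :
    expMeasure r = volume.withDensity (exponentialPDF r) := rfl

theorem measurable_exponentialPDF (r : ℝ) : Measurable (exponentialPDF r) :=
  (measurable_exponentialPDFReal r).ennreal_ofReal

theorem ae_nonneg_expMeasure (r : ℝ) : ∀ᵐ e ∂expMeasure r, 0 ≤ e := by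
  rw [expMeasure_eq_withDensity, ae_withDensity_iff (measurable_exponentialPDF r)]
  refine Eventually.of_forall fun e he ↦ ?_
  by_contra h
  exact he (exponentialPDF_of_neg (not_le.1 h))

theorem toReal_exponentialPDF_mul_exp {r : ℝ} (hr : 0 < r) (s x : ℝ) :
    (exponentialPDF r x).toReal • Real.exp (s * x) =
      (Set.Ici 0).indicator (fun x ↦ r * Real.exp ((s - r) * x)) x := by
  rw [exponentialPDF_eq]
  by_cases hx : 0 ≤ x
  · rw [Set.indicator_of_mem (Set.mem_Ici.2 hx), if_pos hx, ENNReal.toReal_ofReal (by positivity),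
      smul_eq_mul, mul_assoc, ← Real.exp_add]
    congr 2
    ring
  · rw [Set.indicator_of_notMem (by simpa using hx), if_neg hx]
    simp

theorem integrable_exp_mul_expMeasure {r s : ℝ} (hr : 0 < r) (hs : s < r) :
    Integrable (fun e ↦ Real.exp (s * e)) (expMeasure r) := by
  rw [expMeasure_eq_withDensity,
    integrable_withDensity_iff_integrable_smul' (measurable_exponentialPDF r)
      (Eventually.of_forall fun _ ↦ ENNReal.ofReal_lt_top)]
  simp_rw [toReal_exponentialPDF_mul_exp hr]
  rw [integrable_indicator_iff measurableSet_Ici, integrableOn_Ici_iff_integrableOn_Ioi]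
  exact (integrableOn_exp_mul_Ioi (sub_neg.2 hs) 0).const_mul r

theorem integral_exp_mul_expMeasure {r s : ℝ} (hr : 0 < r) (hs : s < r) :
    ∫ e, Real.exp (s * e) ∂expMeasure r = r / (r - s) := by
  rw [expMeasure_eq_withDensity,
    integral_withDensity_eq_integral_toReal_smul (measurable_exponentialPDF r)
      (Eventually.of_forall fun _ ↦ ENNReal.ofReal_lt_top)]
  simp_rw [toReal_exponentialPDF_mul_exp hr]
  rw [integral_indicator measurableSet_Ici, integral_Ici_eq_integral_Ioi, integral_const_mul,
    integral_exp_mul_Ioi (sub_neg.2 hs), ← neg_sub r s, mul_zero, Real.exp_zero, neg_div_neg_eq,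
    mul_one_div]

/-- The law of a shifted exponential variable, by its density. -/
theorem expMeasure_preimage_add (r z : ℝ) {A : Set ℝ} (hA : MeasurableSet A) :
    expMeasure r ((z + ·) ⁻¹' A) = ∫⁻ y in A, exponentialPDF r (y - z) := by
  rw [expMeasure_eq_withDensity, withDensity_apply _ (measurable_const_add z hA),
    ← lintegral_indicator (measurable_const_add z hA), ← lintegral_indicator hA,
    ← lintegral_sub_right_eq_self _ z]
  refine lintegral_congr fun y ↦ ?_
  by_cases hy : y ∈ A
  · rw [Set.indicator_of_mem (by simpa using hy), Set.indicator_of_mem hy]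
  · rw [Set.indicator_of_notMem (by simpa using hy), Set.indicator_of_notMem hy]

/-- Shifting by `z ≥ 0` multiplies the density by `exp (r * z) ≥ 1` beyond `z`, in particular on
`[R, ∞)`. The lower bound is therefore uniform over `z ∈ [0, R]`. -/
theorem restrict_Ici_expMeasure_le {r z R : ℝ} (hr : 0 < r) (hz : 0 ≤ z) (hzR : z ≤ R)
    {A : Set ℝ} (hA : MeasurableSet A) :
    (expMeasure r).restrict (Set.Ici R) A ≤ expMeasure r ((z + ·) ⁻¹' A) := by
  rw [expMeasure_preimage_add r z hA, Measure.restrict_apply hA, expMeasure_eq_withDensity,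
    withDensity_apply _ (hA.inter measurableSet_Ici)]
  refine (setLIntegral_mono (measurable_exponentialPDF r |>.comp (measurable_id.sub_const z))
    fun y hy ↦ ?_).trans (lintegral_mono_set Set.inter_subset_left)
  have hRy : R ≤ y := hy.2
  rw [Function.comp_apply, id, exponentialPDF_of_nonneg (by linarith),
    exponentialPDF_of_nonneg (by linarith)]
  gcongr
  linarith

theorem restrict_Ici_expMeasure_ne_zero {r : ℝ} (hr : 0 < r) (R : ℝ) :
    (expMeasure r).restrict (Set.Ici R) ≠ 0 := by
  have := isProbabilityMeasure_expMeasure hr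
  intro h
  have h₀ : expMeasure r (Set.Iic R)ᶜ = 0 := by
    rw [Set.compl_Iic]
    exact measure_mono_null Set.Ioi_subset_Ici_self (Measure.restrict_eq_zero.1 h)
  have h₁ : expMeasure r (Set.Iic R) = 1 := (prob_compl_eq_zero_iff measurableSet_Iic).1 h₀
  rw [expMeasure_eq_withDensity, withDensity_apply _ measurableSet_Iic,
    lintegral_exponentialPDF_eq_antiDeriv hr, ENNReal.ofReal_eq_one] at h₁
  have := Real.exp_pos (-(r * R))
  split_ifs at h₁ <;> linarith

end Exponential

/-! ### The buffer kernel: drift and small sets. -/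

section BufferStep

theorem bufferStep_eq_add (M Γ x : ℝ) (s : Slot) (e : ℝ) :
    bufferStep M Γ x s e = levelAfterDischarge M Γ x s + e := by
  unfold bufferStep levelAfterDischarge
  split_ifs <;> rfl

theorem measurable_levelAfterDischarge (M Γ : ℝ) :
    Measurable fun z : ℝ × Slot ↦ levelAfterDischarge M Γ z.1 z.2 :=
  Measurable.ite ((measurableSet_le measurable_const measurable_fst).inter
    (measurable_snd (measurableSet_dischargeSlots Γ))) (measurable_fst.sub_const M) measurable_fst

theorem measurable_bufferStep (M Γ : ℝ) :
    Measurable fun z : ℝ × Slot × ℝ ↦ bufferStep M Γ z.1 z.2.1 z.2.2 := by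
  simp_rw [bufferStep_eq_add]
  exact ((measurable_levelAfterDischarge M Γ).comp
    (measurable_fst.prodMk (measurable_fst.comp measurable_snd))).add
    (measurable_snd.comp measurable_snd)

/-- Clamping at `0` makes the drift and small-set bounds valid from every real starting point; laws
carried by `[0, ∞)` do not notice it. -/
theorem measurable_bufferStep_max (M Γ : ℝ) :
    Measurable fun z : ℝ × Slot × ℝ ↦ bufferStep M Γ (max z.1 0) z.2.1 z.2.2 :=
  (measurable_bufferStep M Γ).comp
    ((measurable_fst.max measurable_const).prodMk measurable_snd)

theorem levelAfterDischarge_nonneg {M Γ x : ℝ} (hx : 0 ≤ x) (s : Slot) :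
    0 ≤ levelAfterDischarge M Γ x s := by
  unfold levelAfterDischarge
  split_ifs with h
  · linarith [h.1]
  · exact hx

theorem levelAfterDischarge_le {M Γ : ℝ} (hM : 0 ≤ M) (x : ℝ) (s : Slot) :
    levelAfterDischarge M Γ x s ≤ x := by
  unfold levelAfterDischarge
  split_ifs <;> linarith

end BufferStep

noncomputable section

/-- The transition kernel of the buffer level, with negative levels treated as `0`. -/
def bufferKernel (lam M Γ : ℝ) (ρ : Measure Slot) [SFinite (ρ.prod (expMeasure lam))] :
    Kernel ℝ ℝ :=
  randomMapKernel (ρ.prod (expMeasure lam))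
    (fun z ↦ bufferStep M Γ (max z.1 0) z.2.1 z.2.2) (measurable_bufferStep_max M Γ)

end

section BufferKernel

theorem integral_exp_mul_levelAfterDischarge {M Γ s x : ℝ} (ρ : Measure Slot)
    [IsProbabilityMeasure ρ] (hx : M ≤ x) :
    ∫ σ, Real.exp (s * levelAfterDischarge M Γ x σ) ∂ρ =
      (1 - ρ.real (dischargeSlots Γ) + ρ.real (dischargeSlots Γ) * Real.exp (-(s * M))) *
        Real.exp (s * x) := by
  have e : ∀ σ, Real.exp (s * levelAfterDischarge M Γ x σ) = Real.exp (s * x) *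
      (1 + (dischargeSlots Γ).indicator (fun _ ↦ Real.exp (-(s * M)) - 1) σ) := fun σ ↦ by
    by_cases hσ : σ ∈ dischargeSlots Γ
    · rw [Set.indicator_of_mem hσ, levelAfterDischarge, if_pos ⟨hx, hσ⟩, add_sub_cancel,
        ← Real.exp_add]
      congr 1
      ring
    · rw [Set.indicator_of_notMem hσ, levelAfterDischarge, if_neg fun h ↦ hσ h.2]
      simp
  simp_rw [e]
  rw [integral_const_mul, integral_add (integrable_const _)
    ((integrable_const _).indicator (measurableSet_dischargeSlots Γ)),
    integral_indicator_const _ (measurableSet_dischargeSlots Γ)]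
  simp only [integral_const, probReal_univ, smul_eq_mul]
  ring

theorem measurable_bufferStep_max_right (M Γ x : ℝ) :
    Measurable fun w : Slot × ℝ ↦ bufferStep M Γ (max x 0) w.1 w.2 :=
  (measurable_bufferStep_max M Γ).comp measurable_prodMk_left

theorem bufferKernel_apply (lam M Γ : ℝ) (ρ : Measure Slot) [SFinite (ρ.prod (expMeasure lam))]
    (x : ℝ) : bufferKernel lam M Γ ρ x =
      (ρ.prod (expMeasure lam)).map fun w ↦ bufferStep M Γ (max x 0) w.1 w.2 := rfl

variable {lam M Γ : ℝ} {ρ : Measure Slot}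

theorem exp_mul_max_bufferStep_ae_eq (s x : ℝ) :
    (fun w : Slot × ℝ ↦ Real.exp (s * max (bufferStep M Γ (max x 0) w.1 w.2) 0)) =ᵐ[
      ρ.prod (expMeasure lam)]
    fun w ↦ Real.exp (s * levelAfterDischarge M Γ (max x 0) w.1) * Real.exp (s * w.2) := by
  filter_upwards [Measure.quasiMeasurePreserving_snd.ae (ae_nonneg_expMeasure lam)] with w hw
  rw [bufferStep_eq_add, max_eq_left
    (add_nonneg (levelAfterDischarge_nonneg (le_max_right x 0) _) hw), mul_add, Real.exp_add]

variable [IsProbabilityMeasure ρ]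

theorem integrable_exp_mul_levelAfterDischarge {s : ℝ} (hM : 0 ≤ M) (hs : 0 ≤ s) (x : ℝ) :
    Integrable (fun σ ↦ Real.exp (s * levelAfterDischarge M Γ x σ)) ρ := by
  refine Integrable.of_bound (C := Real.exp (s * x)) ?_ (Eventually.of_forall fun σ ↦ ?_)
  · exact (((measurable_levelAfterDischarge M Γ).comp measurable_prodMk_left).const_mul
      s).exp.aestronglyMeasurable
  · rw [Real.norm_eq_abs, Real.abs_exp]
    gcongr
    exact levelAfterDischarge_le hM x σ

theorem measurable_exp_mul_max (s : ℝ) : Measurable fun x : ℝ ↦ Real.exp (s * max x 0) :=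
  ((measurable_id.max measurable_const).const_mul s).exp

variable [IsProbabilityMeasure (expMeasure lam)]

theorem integrable_exp_mul_max_bufferKernel {s : ℝ} (hlam : 0 < lam) (hM : 0 ≤ M) (hs : 0 ≤ s)
    (hs' : s < lam) (x : ℝ) :
    Integrable (fun y ↦ Real.exp (s * max y 0)) (bufferKernel lam M Γ ρ x) := by
  rw [bufferKernel_apply, integrable_map_measure
    (measurable_exp_mul_max s).aestronglyMeasurable
    (measurable_bufferStep_max_right M Γ x).aemeasurable]
  exact (integrable_congr (exp_mul_max_bufferStep_ae_eq s x)).2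
    ((integrable_exp_mul_levelAfterDischarge hM hs _).mul_prod
      (integrable_exp_mul_expMeasure hlam hs'))

/-- Discharge and harvest are independent, so the exponential moment factorizes. Below `M` the level
after discharge is at most `M`, and this case goes into the additive constant. -/
theorem integral_exp_mul_max_bufferKernel_le {s : ℝ} (hlam : 0 < lam) (hM : 0 ≤ M) (hs : 0 ≤ s)
    (hs' : s < lam) (x : ℝ) :
    ∫ y, Real.exp (s * max y 0) ∂bufferKernel lam M Γ ρ x ≤
      (1 - ρ.real (dischargeSlots Γ) + ρ.real (dischargeSlots Γ) * Real.exp (-(s * M))) *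
        (lam / (lam - s)) * Real.exp (s * max x 0) + Real.exp (s * M) * (lam / (lam - s)) := by
  have hpos : 0 < lam / (lam - s) := div_pos hlam (sub_pos.2 hs')
  have hb : ρ.real (dischargeSlots Γ) ≤ 1 := measureReal_le_one
  have hcoef : 0 ≤ 1 - ρ.real (dischargeSlots Γ) +
      ρ.real (dischargeSlots Γ) * Real.exp (-(s * M)) :=
    add_nonneg (sub_nonneg.2 hb) (mul_nonneg measureReal_nonneg (Real.exp_pos _).le)
  rw [bufferKernel_apply, integral_map
    (measurable_bufferStep_max_right M Γ x).aemeasurable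
    (measurable_exp_mul_max s).aestronglyMeasurable,
    integral_congr_ae (exp_mul_max_bufferStep_ae_eq s x),
    integral_prod_mul (fun σ ↦ Real.exp (s * levelAfterDischarge M Γ (max x 0) σ))
      (fun e ↦ Real.exp (s * e)), integral_exp_mul_expMeasure hlam hs']
  rcases le_or_gt M (max x 0) with hx | hx
  · rw [integral_exp_mul_levelAfterDischarge ρ hx]
    have : 0 ≤ Real.exp (s * M) * (lam / (lam - s)) := by positivity
    linarith
  · have hle : ∫ σ, Real.exp (s * levelAfterDischarge M Γ (max x 0) σ) ∂ρ ≤ Real.exp (s * M) := by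
      have h := integral_mono (integrable_exp_mul_levelAfterDischarge (ρ := ρ) (Γ := Γ) hM hs
        (max x 0)) (integrable_const (Real.exp (s * M))) fun σ ↦ by
          simp only
          gcongr
          exact (levelAfterDischarge_le hM _ σ).trans hx.le
      simpa using h
    have h₁ := mul_le_mul_of_nonneg_right hle hpos.le
    have h₂ : 0 ≤ (1 - ρ.real (dischargeSlots Γ) + ρ.real (dischargeSlots Γ) *
        Real.exp (-(s * M))) * (lam / (lam - s)) * Real.exp (s * max x 0) := by positivity
    linarith

theorem restrict_Ici_expMeasure_le_bufferKernel (hlam : 0 < lam) (hM : 0 ≤ M) {R x : ℝ}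
    (hx : max x 0 ≤ R) : (expMeasure lam).restrict (Set.Ici R) ≤ bufferKernel lam M Γ ρ x := by
  refine Measure.le_iff.2 fun A hA ↦ ?_
  have hf := measurable_bufferStep_max_right M Γ x
  rw [bufferKernel_apply, Measure.map_apply hf hA, Measure.prod_apply (hf hA)]
  calc (expMeasure lam).restrict (Set.Ici R) A
      = ∫⁻ _, (expMeasure lam).restrict (Set.Ici R) A ∂ρ := by simp
    _ ≤ _ := lintegral_mono fun σ ↦ by
      refine (restrict_Ici_expMeasure_le hlam
        (levelAfterDischarge_nonneg (M := M) (Γ := Γ) (le_max_right x 0) σ)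
        ((levelAfterDischarge_le hM _ σ).trans hx) hA).trans_eq ?_
      congr 1
      ext e
      simp [bufferStep_eq_add]

end BufferKernel

/-! ### The limiting density. -/

section LimitDensity

variable {b lam M Q x : ℝ}

theorem limitDensity_of_neg (hx : x < 0) : limitDensity b lam M Q x = 0 := if_pos hx

theorem limitDensity_of_lt (hx₀ : 0 ≤ x) (hx : x < M) :
    limitDensity b lam M Q x = 1 / M * (1 - Real.exp (Q * x)) := by
  rw [limitDensity, if_neg hx₀.not_gt, if_pos hx]

theorem limitDensity_of_le (hM : 0 < M) (hx : M ≤ x) :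
    limitDensity b lam M Q x = 1 / M * (-Q * Real.exp (Q * x) / (b * lam + Q)) := by
  rw [limitDensity, if_neg (hM.le.trans hx).not_gt, if_neg hx.not_gt]

theorem limitDensity_nonneg (hM : 0 < M) (hQ : Q < 0) (hbQ : 0 < b * lam + Q) (x : ℝ) :
    0 ≤ limitDensity b lam M Q x := by
  rcases lt_or_ge x 0 with hx | hx
  · rw [limitDensity_of_neg hx]
  rcases lt_or_ge x M with hxM | hxM
  · rw [limitDensity_of_lt hx hxM]
    have : Real.exp (Q * x) ≤ 1 := Real.exp_le_one_iff.2 (mul_nonpos_of_nonpos_of_nonneg hQ.le hx)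
    exact mul_nonneg (by positivity) (sub_nonneg.2 this)
  · rw [limitDensity_of_le hM hxM]
    have := neg_pos.2 hQ
    positivity

/-- The two branches of the density agree at `M`; this is the equation for `Q` in another form. -/
theorem one_sub_exp_eq (hc : 0 < b * lam)
    (heq : b * lam * Real.exp (Q * M) = b * lam + Q) :
    1 - Real.exp (Q * M) = -Q * Real.exp (Q * M) / (b * lam + Q) := by
  have hbQ : b * lam + Q ≠ 0 := heq ▸ (mul_pos hc (Real.exp_pos _)).ne'
  rw [eq_div_iff hbQ]
  linear_combination -heq

theorem continuous_limitDensity (hM : 0 < M) (hc : 0 < b * lam)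
    (heq : b * lam * Real.exp (Q * M) = b * lam + Q) :
    Continuous (limitDensity b lam M Q) := by
  have e : limitDensity b lam M Q = fun x ↦ if 0 ≤ x then
      if M ≤ x then 1 / M * (-Q * Real.exp (Q * x) / (b * lam + Q))
      else 1 / M * (1 - Real.exp (Q * x)) else 0 := by
    funext x
    simp only [limitDensity, ← not_lt, ite_not]
  rw [e]
  refine Continuous.if_le (Continuous.if_le (by fun_prop) (by fun_prop) continuous_const
    continuous_id ?_) continuous_const continuous_const continuous_id ?_
  · rintro x rfl
    rw [one_sub_exp_eq hc heq]
  · rintro x rfl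
    simp [hM.not_ge]

theorem hasDerivAt_limitDensity_of_lt (hx₀ : 0 < x) (hx : x < M) :
    HasDerivAt (limitDensity b lam M Q) (1 / M * (-Q * Real.exp (Q * x))) x := by
  have h : HasDerivAt (fun x ↦ 1 / M * (1 - Real.exp (Q * x))) (1 / M * (-Q * Real.exp (Q * x)))
      x :=
    (((((hasDerivAt_id x).const_mul Q).exp).const_sub 1).const_mul (1 / M)).congr_deriv
      (by simp only [id]; ring)
  refine h.congr_of_eventuallyEq ?_
  filter_upwards [Ioo_mem_nhds hx₀ hx] with y hy
  exact limitDensity_of_lt hy.1.le hy.2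

theorem hasDerivAt_limitDensity_of_gt (hM : 0 < M) (hx : M < x) :
    HasDerivAt (limitDensity b lam M Q) (Q * limitDensity b lam M Q x) x := by
  have h : HasDerivAt (fun x ↦ 1 / M * (-Q * Real.exp (Q * x) / (b * lam + Q)))
      (Q * limitDensity b lam M Q x) x :=
    ((((((hasDerivAt_id x).const_mul Q).exp).const_mul (-Q)).div_const
      (b * lam + Q)).const_mul (1 / M)).congr_deriv
      (by rw [limitDensity_of_le hM hx.le]; simp only [id]; ring)
  refine h.congr_of_eventuallyEq ?_
  filter_upwards [Ioi_mem_nhds hx] with y hy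
  exact limitDensity_of_le hM (le_of_lt hy)

/-- By the equation for `Q`, the branches below and above `M` have masses `1 - 1 / (b * lam * M)`
and `1 / (b * lam * M)`. -/
theorem isProbabilityMeasure_limitLaw (hM : 0 < M) (hQ : Q < 0) (hc : 0 < b * lam)
    (heq : b * lam * Real.exp (Q * M) = b * lam + Q) :
    IsProbabilityMeasure (limitLaw b lam M Q) := by
  have hbQ : 0 < b * lam + Q := heq ▸ mul_pos hc (Real.exp_pos _)
  have e : limitDensity b lam M Q = fun x ↦
      (Set.Ico 0 M).indicator (fun x ↦ 1 / M * (1 - Real.exp (Q * x))) x +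
      (Set.Ici M).indicator (fun x ↦ 1 / M * (-Q / (b * lam + Q)) * Real.exp (Q * x)) x := by
    funext x
    rcases lt_or_ge x 0 with hx | hx
    · rw [limitDensity_of_neg hx, Set.indicator_of_notMem (by simp [hx]),
        Set.indicator_of_notMem (by simpa using hx.trans hM), add_zero]
    rcases lt_or_ge x M with hxM | hxM
    · rw [limitDensity_of_lt hx hxM, Set.indicator_of_mem (Set.mem_Ico.2 ⟨hx, hxM⟩),
        Set.indicator_of_notMem (by simpa using hxM), add_zero]
    · rw [limitDensity_of_le hM hxM, Set.indicator_of_notMem (by simp [hxM]),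
        Set.indicator_of_mem (Set.mem_Ici.2 hxM)]
      ring
  have i₁ : IntegrableOn (fun x ↦ 1 / M * (1 - Real.exp (Q * x))) (Set.Ico 0 M) :=
    (Continuous.integrableOn_Icc (by fun_prop)).mono_set Set.Ico_subset_Icc_self
  have i₂ : IntegrableOn (fun x ↦ 1 / M * (-Q / (b * lam + Q)) * Real.exp (Q * x)) (Set.Ici M) := by
    rw [integrableOn_Ici_iff_integrableOn_Ioi]
    exact (integrableOn_exp_mul_Ioi hQ M).const_mul _
  have hint : Integrable (limitDensity b lam M Q) := by
    rw [e]
    exact (i₁.integrable_indicator measurableSet_Ico).add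
      (i₂.integrable_indicator measurableSet_Ici)
  have hone : ∫ x, limitDensity b lam M Q x = 1 := by
    rw [e, integral_add (i₁.integrable_indicator measurableSet_Ico)
      (i₂.integrable_indicator measurableSet_Ici), integral_indicator measurableSet_Ico,
      integral_indicator measurableSet_Ici, integral_Ici_eq_integral_Ioi, integral_const_mul,
      integral_const_mul, integral_exp_mul_Ioi hQ, integral_Ico_eq_integral_Ioc,
      ← intervalIntegral.integral_of_le hM.le, intervalIntegral.integral_sub (by simp)
        (Continuous.intervalIntegrable (by fun_prop) _ _),
      intervalIntegral.integral_comp_mul_left (fun x ↦ Real.exp x) hQ.ne, integral_exp]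
    simp only [intervalIntegral.integral_const, smul_eq_mul, mul_zero, Real.exp_zero, mul_one,
      sub_zero]
    have hQ' := hQ.ne
    have e₁ : Real.exp (Q * M) - 1 = Q / (b * lam) := by
      rw [eq_div_iff hc.ne']
      linear_combination heq
    have e₂ : Real.exp (Q * M) = (b * lam + Q) / (b * lam) := by
      rw [eq_div_iff hc.ne', ← heq, mul_comm]
    rw [e₁, e₂]
    field_simp
    ring
  refine ⟨?_⟩
  rw [limitLaw, withDensity_apply _ MeasurableSet.univ, setLIntegral_univ,
    ← ofReal_integral_eq_lintegral_ofReal hint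
      (Eventually.of_forall (limitDensity_nonneg hM hQ hbQ)), hone, ENNReal.ofReal_one]

end LimitDensity

/-! ### Stationarity of the limiting law. -/

noncomputable section

/-- The density of the level after a possible discharge in the limiting regime. -/
def densityAfterDischarge (b lam M Q x : ℝ) : ℝ :=
  if x < 0 then 0
  else (if x < M then 1 else 1 - b) * limitDensity b lam M Q x + b * limitDensity b lam M Q (x + M)

end

section Stationarity

variable {b lam M Q : ℝ}

theorem densityAfterDischarge_nonneg (hM : 0 < M) (hQ : Q < 0) (hbQ : 0 < b * lam + Q)
    (hb₀ : 0 ≤ b) (hb₁ : b ≤ 1) (x : ℝ) : 0 ≤ densityAfterDischarge b lam M Q x := by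
  have h₁ := limitDensity_nonneg (b := b) (lam := lam) hM hQ hbQ x
  have h₂ := limitDensity_nonneg (b := b) (lam := lam) hM hQ hbQ (x + M)
  have h₃ := sub_nonneg.2 hb₁
  unfold densityAfterDischarge
  split_ifs <;> positivity

theorem measurable_densityAfterDischarge (hM : 0 < M) (hc : 0 < b * lam)
    (heq : b * lam * Real.exp (Q * M) = b * lam + Q) :
    Measurable (densityAfterDischarge b lam M Q) := by
  have hg := (continuous_limitDensity hM hc heq).measurable
  exact Measurable.ite measurableSet_Iio measurable_const
    (((Measurable.ite measurableSet_Iio measurable_const measurable_const).mul hg).add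
      ((hg.comp (measurable_add_const M)).const_mul b))

/-- The balance equation `g' + λ g = λ k` between the limiting density `g` and the density `k`
after discharge. -/
theorem hasDerivAt_limitDensity_mul_exp (hM : 0 < M) (hc : 0 < b * lam)
    (heq : b * lam * Real.exp (Q * M) = b * lam + Q) {x y : ℝ} (hx : 0 < x) (hxM : x ≠ M) :
    HasDerivAt (fun x ↦ limitDensity b lam M Q x * Real.exp (-(lam * (y - x))))
      (densityAfterDischarge b lam M Q x * (lam * Real.exp (-(lam * (y - x))))) x := by
  have he : HasDerivAt (fun x ↦ Real.exp (-(lam * (y - x))))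
      (Real.exp (-(lam * (y - x))) * lam) x :=
    ((((hasDerivAt_id x).const_sub y).const_mul lam).fun_neg.exp).congr_deriv (by simp)
  have hE := (Real.exp_pos (Q * M)).ne'
  -- The denominator `b * lam + Q` equals `b * lam * exp (Q * M)`, which absorbs the shift by `M`.
  have hshift : limitDensity b lam M Q (x + M) = 1 / M * (-Q * Real.exp (Q * x) / (b * lam)) := by
    rw [limitDensity_of_le hM (by linarith), ← heq, mul_add, Real.exp_add]
    field_simp
  have hb : b ≠ 0 := left_ne_zero_of_mul hc.ne'
  have hl : lam ≠ 0 := right_ne_zero_of_mul hc.ne'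
  rcases lt_or_gt_of_ne hxM with h | h
  · refine ((hasDerivAt_limitDensity_of_lt hx h).mul he).congr_deriv ?_
    rw [densityAfterDischarge, if_neg hx.not_gt, if_pos h, hshift]
    field_simp
    ring
  · refine ((hasDerivAt_limitDensity_of_gt hM h).mul he).congr_deriv ?_
    have hg : b * lam * limitDensity b lam M Q (x + M) =
        (b * lam + Q) * limitDensity b lam M Q x := by
      rw [hshift, limitDensity_of_le hM h.le]
      have : b * lam + Q ≠ 0 := by rw [← heq]; positivity
      field_simp
    rw [densityAfterDischarge, if_neg hx.not_gt, if_neg h.not_gt]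
    linear_combination (-Real.exp (-(lam * (y - x)))) * hg

/-- The convolution with the exponential density is the balance equation integrated over `[0, y]`
with integrating factor `exp (-(lam * (y - x)))`; the boundary term at `0` vanishes. -/
theorem lintegral_densityAfterDischarge_mul (hlam : 0 < lam) (hM : 0 < M) (hQ : Q < 0)
    (hb₀ : 0 < b) (hb₁ : b ≤ 1)
    (heq : b * lam * Real.exp (Q * M) = b * lam + Q) (y : ℝ) :
    ∫⁻ x, ENNReal.ofReal (densityAfterDischarge b lam M Q x) * exponentialPDF lam (y - x) =
      ENNReal.ofReal (limitDensity b lam M Q y) := by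
  have hc : 0 < b * lam := mul_pos hb₀ hlam
  have hbQ : 0 < b * lam + Q := heq ▸ mul_pos hc (Real.exp_pos _)
  have hk := densityAfterDischarge_nonneg (b := b) (lam := lam) hM hQ hbQ hb₀.le hb₁
  have hcont := continuous_limitDensity hM hc heq
  rcases lt_or_ge y 0 with hy | hy
  · rw [limitDensity_of_neg hy, ENNReal.ofReal_zero, lintegral_eq_zero_of_ae_eq_zero]
    refine Eventually.of_forall fun x ↦ ?_
    rcases lt_or_ge x 0 with hx | hx
    · simp [densityAfterDischarge, hx]
    · simp [exponentialPDF_of_neg (show y - x < 0 by linarith)]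
  have e : ∀ x, ENNReal.ofReal (densityAfterDischarge b lam M Q x) * exponentialPDF lam (y - x) =
      (Set.Icc 0 y).indicator (fun x ↦ ENNReal.ofReal (densityAfterDischarge b lam M Q x *
        (lam * Real.exp (-(lam * (y - x)))))) x := fun x ↦ by
    by_cases hx : x ∈ Set.Icc 0 y
    · rw [Set.indicator_of_mem hx, exponentialPDF_of_nonneg (sub_nonneg.2 hx.2),
        ENNReal.ofReal_mul (hk x)]
    · rw [Set.indicator_of_notMem hx]
      rcases lt_or_ge x 0 with hx₀ | hx₀
      · simp [densityAfterDischarge, hx₀]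
      · have : y - x < 0 := sub_neg.2 (not_le.1 fun h ↦ hx ⟨hx₀, h⟩)
        simp [exponentialPDF_of_neg this]
  have hint : IntegrableOn (fun x ↦ densityAfterDischarge b lam M Q x *
      (lam * Real.exp (-(lam * (y - x))))) (Set.Icc 0 y) := by
    refine Integrable.mono' (g := fun x ↦ (limitDensity b lam M Q x +
      b * limitDensity b lam M Q (x + M)) * (lam * Real.exp (-(lam * (y - x)))))
      (Continuous.integrableOn_Icc (by fun_prop))
      ((measurable_densityAfterDischarge hM hc heq).mul (by fun_prop)).aestronglyMeasurable
      (Eventually.of_forall fun x ↦ ?_)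
    have h₁ := limitDensity_nonneg (b := b) (lam := lam) hM hQ hbQ x
    have h₂ := mul_nonneg hb₀.le (limitDensity_nonneg (b := b) (lam := lam) hM hQ hbQ (x + M))
    have hpos : 0 ≤ lam * Real.exp (-(lam * (y - x))) := by positivity
    rw [Real.norm_of_nonneg (mul_nonneg (hk x) hpos)]
    refine mul_le_mul_of_nonneg_right ?_ hpos
    unfold densityAfterDischarge
    split_ifs
    · linarith
    · linarith
    · nlinarith
  simp_rw [e]
  -- The fundamental theorem of calculus needs only continuity at the point `M`, where the branches
  -- meet.
  rw [lintegral_indicator measurableSet_Icc, ← ofReal_integral_eq_lintegral_ofReal hint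
    (Eventually.of_forall fun x ↦ mul_nonneg (hk x) (by positivity)),
    integral_Icc_eq_integral_Ioc, ← intervalIntegral.integral_of_le hy,
    MeasureTheory.integral_eq_of_hasDerivAt_off_countable_of_le
      (fun x ↦ limitDensity b lam M Q x * Real.exp (-(lam * (y - x)))) _ hy
      (Set.countable_singleton M) (Continuous.continuousOn (by fun_prop))
      (fun x hx ↦ hasDerivAt_limitDensity_mul_exp hM hc heq hx.1.1 hx.2)
      ((intervalIntegrable_iff_integrableOn_Icc_of_le hy).2 hint)]
  simp [limitDensity_of_lt le_rfl hM]

theorem lintegral_levelAfterDischarge (ρ : Measure Slot) (Γ x : ℝ) [IsProbabilityMeasure ρ]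
    {h : ℝ → ENNReal} :
    ∫⁻ σ, h (levelAfterDischarge M Γ x σ) ∂ρ =
      if M ≤ x then ρ (dischargeSlots Γ) * h (x - M) + ρ (dischargeSlots Γ)ᶜ * h x else h x := by
  have hD := measurableSet_dischargeSlots Γ
  split_ifs with hx
  · rw [← lintegral_add_compl _ hD,
      setLIntegral_congr_fun (g := fun _ ↦ h (x - M)) hD fun σ hσ ↦ by
        simp only [levelAfterDischarge, if_pos (And.intro hx hσ)],
      setLIntegral_congr_fun (g := fun _ ↦ h x) hD.compl fun σ hσ ↦ by
        simp only [levelAfterDischarge, if_neg (fun h : _ ∧ _ ↦ hσ h.2)],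
      setLIntegral_const, setLIntegral_const, mul_comm, mul_comm (h x)]
  · simp [levelAfterDischarge, hx]

/-- The mass splits into a part `u` that discharges and a part `v` that stays; translation
invariance of Lebesgue measure moves `u` down by `M`. -/
theorem lintegral_limitDensity_mul_levelAfterDischarge (hlam : 0 < lam) (hM : 0 < M) (hQ : Q < 0)
    (hb₀ : 0 < b) (hb₁ : b ≤ 1) (heq : b * lam * Real.exp (Q * M) = b * lam + Q)
    {ρ : Measure Slot} [IsProbabilityMeasure ρ] {Γ : ℝ} (hb : ρ.real (dischargeSlots Γ) = b)
    {h : ℝ → ENNReal} (hh : Measurable h) :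
    ∫⁻ x, ENNReal.ofReal (limitDensity b lam M Q x) *
        ∫⁻ σ, h (levelAfterDischarge M Γ x σ) ∂ρ =
      ∫⁻ x, ENNReal.ofReal (densityAfterDischarge b lam M Q x) * h x := by
  have hc : 0 < b * lam := mul_pos hb₀ hlam
  have hbQ : 0 < b * lam + Q := heq ▸ mul_pos hc (Real.exp_pos _)
  have hg := limitDensity_nonneg (b := b) (lam := lam) hM hQ hbQ
  have hgm := (continuous_limitDensity hM hc heq).measurable
  have hρ : ρ (dischargeSlots Γ) = ENNReal.ofReal b := by
    rw [← hb, ofReal_measureReal]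
  have hρ' : ρ (dischargeSlots Γ)ᶜ = ENNReal.ofReal (1 - b) := by
    rw [← hb, ← probReal_compl_eq_one_sub (measurableSet_dischargeSlots Γ), ofReal_measureReal]
  set u : ℝ → ENNReal := (Set.Ici M).indicator
    (fun x ↦ ENNReal.ofReal (b * limitDensity b lam M Q x)) with hu
  have hum : Measurable u := (hgm.const_mul b).ennreal_ofReal.indicator measurableSet_Ici
  set v : ℝ → ENNReal :=
    fun x ↦ ENNReal.ofReal ((if x < M then 1 else 1 - b) * limitDensity b lam M Q x) with hv
  have hvm : Measurable v := ((Measurable.ite measurableSet_Iio measurable_const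
    measurable_const).mul hgm).ennreal_ofReal
  have e₁ : ∀ x, ENNReal.ofReal (limitDensity b lam M Q x) *
      ∫⁻ σ, h (levelAfterDischarge M Γ x σ) ∂ρ = u x * h (x - M) + v x * h x := fun x ↦ by
    rw [lintegral_levelAfterDischarge, hρ, hρ']
    rcases lt_or_ge x M with hx | hx
    · simp [hu, hv, hx, hx.not_ge]
    · rw [if_pos hx, hu, Set.indicator_of_mem (Set.mem_Ici.2 hx), hv]
      simp only [if_neg hx.not_gt]
      rw [ENNReal.ofReal_mul hb₀.le, ENNReal.ofReal_mul (sub_nonneg.2 hb₁)]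
      ring
  have e₂ : ∀ x, ENNReal.ofReal (densityAfterDischarge b lam M Q x) * h x =
      u (x + M) * h (x + M - M) + v x * h x := fun x ↦ by
    rw [add_sub_cancel_right, ← add_mul]
    congr 1
    rcases lt_or_ge x 0 with hx | hx
    · simp [densityAfterDischarge, hx, hu, hv, limitDensity_of_neg hx]
    · rw [densityAfterDischarge, if_neg hx.not_gt, hu,
        Set.indicator_of_mem (by simpa using hx), hv, add_comm, ENNReal.ofReal_add
          (mul_nonneg hb₀.le (hg _)) (mul_nonneg (by split_ifs <;> linarith) (hg _))]
  simp_rw [e₁, e₂]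
  have hm : Measurable fun x ↦ v x * h x := hvm.mul hh
  rw [lintegral_add_right _ hm, lintegral_add_right _ hm,
    lintegral_add_right_eq_self (fun x ↦ u x * h (x - M)) M]

theorem isStationaryLaw_limitLaw (hlam : 0 < lam) (hM : 0 < M) (hQ : Q < 0)
    (hb₀ : 0 < b) (hb₁ : b ≤ 1) (heq : b * lam * Real.exp (Q * M) = b * lam + Q)
    {ρ : Measure Slot} [IsProbabilityMeasure ρ] {Γ : ℝ} (hb : ρ.real (dischargeSlots Γ) = b) :
    IsStationaryLaw lam M Γ ρ (limitLaw b lam M Q) := by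
  have hc : 0 < b * lam := mul_pos hb₀ hlam
  have := isProbabilityMeasure_expMeasure hlam
  have hgm := (continuous_limitDensity hM hc heq).measurable.ennreal_ofReal
  have hkm := (measurable_densityAfterDischarge hM hc heq).ennreal_ofReal
  ext A hA
  have hf := measurable_bufferStep M Γ
  have hh : Measurable fun z ↦ expMeasure lam ((z + ·) ⁻¹' A) :=
    measurable_measure_prodMk_left (measurable_add hA)
  have hinner : ∀ x, (ρ.prod (expMeasure lam)) (Prod.mk x ⁻¹'
      ((fun z : ℝ × Slot × ℝ ↦ bufferStep M Γ z.1 z.2.1 z.2.2) ⁻¹' A)) =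
      ∫⁻ σ, expMeasure lam ((levelAfterDischarge M Γ x σ + ·) ⁻¹' A) ∂ρ := fun x ↦ by
    rw [Measure.prod_apply (measurable_prodMk_left (hf hA))]
    refine lintegral_congr fun σ ↦ ?_
    congr 1
    ext e
    simp [bufferStep_eq_add]
  rw [Measure.map_apply hf hA, Measure.prod_apply (hf hA), limitLaw,
    lintegral_withDensity_eq_lintegral_mul _ hgm (measurable_measure_prodMk_left (hf hA)),
    withDensity_apply _ hA]
  simp only [Pi.mul_apply, hinner]
  rw [lintegral_limitDensity_mul_levelAfterDischarge hlam hM hQ hb₀ hb₁ heq hb hh]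
  have hpdf : Measurable fun z : ℝ × ℝ ↦ exponentialPDF lam (z.2 - z.1) :=
    (measurable_exponentialPDF lam).comp (measurable_snd.sub measurable_fst)
  calc ∫⁻ x, ENNReal.ofReal (densityAfterDischarge b lam M Q x) * expMeasure lam ((x + ·) ⁻¹' A)
      = ∫⁻ x, ∫⁻ y in A, ENNReal.ofReal (densityAfterDischarge b lam M Q x) *
          exponentialPDF lam (y - x) := by
        refine lintegral_congr fun x ↦ ?_
        rw [expMeasure_preimage_add lam x hA, lintegral_const_mul]
        exact hpdf.comp measurable_prodMk_left
    _ = ∫⁻ y in A, ∫⁻ x, ENNReal.ofReal (densityAfterDischarge b lam M Q x) *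
          exponentialPDF lam (y - x) :=
        lintegral_lintegral_swap ((hkm.comp measurable_fst).mul hpdf).aemeasurable
    _ = ∫⁻ y in A, ENNReal.ofReal (limitDensity b lam M Q y) := by
        simp_rw [lintegral_densityAfterDischarge_mul hlam hM hQ hb₀ hb₁ heq]

end Stationarity

/-! ### The buffer process: independence of past and present. -/

section BufferProcess

/-- If `U` is independent of `(V, W)`, and `V` of `W`, then `(U, V)` is independent of `W`. -/
theorem indepFun_prodMk_of_indepFun_prodMk {Ω α β γ : Type*} [MeasurableSpace Ω]
    [MeasurableSpace α] [MeasurableSpace β] [MeasurableSpace γ] {P : Measure Ω}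
    [IsProbabilityMeasure P] {U : Ω → α} {V : Ω → β} {W : Ω → γ} (hU : Measurable U)
    (hV : Measurable V) (hW : Measurable W) (h : IndepFun U (fun ω ↦ (V ω, W ω)) P)
    (hVW : IndepFun V W P) : IndepFun (fun ω ↦ (U ω, V ω)) W P := by
  have hUV : IndepFun U V P := h.comp measurable_id measurable_fst
  rw [indepFun_iff_map_prod_eq_prod_map_map hU.aemeasurable (hV.prodMk hW).aemeasurable,
    (indepFun_iff_map_prod_eq_prod_map_map hV.aemeasurable hW.aemeasurable).1 hVW] at h
  rw [indepFun_iff_map_prod_eq_prod_map_map (hU.prodMk hV).aemeasurable hW.aemeasurable,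
    (indepFun_iff_map_prod_eq_prod_map_map hU.aemeasurable hV.aemeasurable).1 hUV]
  apply MeasurableEquiv.prodAssoc.map_measurableEquiv_injective
  have := Measure.isProbabilityMeasure_map (μ := P) hU.aemeasurable
  have := Measure.isProbabilityMeasure_map (μ := P) hV.aemeasurable
  have := Measure.isProbabilityMeasure_map (μ := P) hW.aemeasurable
  rw [Measure.prodAssoc_prod, ← h,
    Measure.map_map MeasurableEquiv.prodAssoc.measurable ((hU.prodMk hV).prodMk hW)]
  rfl

variable {Ω : Type*} [MeasurableSpace Ω] {P : Measure Ω}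
  {lam M Γ : ℝ} {ρ : Measure Slot} {X : ℕ → Ω → ℝ} {T : ℕ → Ω → Slot} {B : ℕ → Ω → ℝ}

/-- The level at time `i` depends only on the initial level and the data of earlier slots, which
makes it independent of slot `i`. -/
theorem IsBufferProcess.exists_measurable_eq (h : IsBufferProcess P lam M Γ ρ X T B) (i : ℕ) :
    ∃ F : ℝ × (Finset.range i → ℝ × Slot) → ℝ, Measurable F ∧
      ∀ ω, B i ω = F (B 0 ω, fun j ↦ (X j ω, T j ω)) := by
  induction i with
  | zero => exact ⟨Prod.fst, measurable_fst, fun _ ↦ rfl⟩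
  | succ i ih =>
    obtain ⟨F, hF, hFB⟩ := ih
    let last : Finset.range (i + 1) := ⟨i, Finset.self_mem_range_succ i⟩
    let incl : Finset.range i → Finset.range (i + 1) := fun j ↦
      ⟨j, Finset.range_subset_range.2 i.le_succ j.2⟩
    refine ⟨fun z ↦ bufferStep M Γ (F (z.1, fun j ↦ z.2 (incl j))) (z.2 last).2 (z.2 last).1,
      ?_, fun ω ↦ ?_⟩
    · have hlast : Measurable fun z : ℝ × (Finset.range (i + 1) → ℝ × Slot) ↦ z.2 last :=
        (measurable_pi_apply last).comp measurable_snd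
      refine (measurable_bufferStep M Γ).comp (Measurable.prodMk (hF.comp (measurable_fst.prodMk
        (measurable_pi_lambda _ fun j ↦ (measurable_pi_apply (incl j)).comp measurable_snd)))
        (Measurable.prodMk (measurable_snd.comp hlast) (measurable_fst.comp hlast)))
    · rw [h.update, hFB]

theorem IsBufferProcess.measurable (h : IsBufferProcess P lam M Γ ρ X T B) (i : ℕ) :
    Measurable (B i) := by
  induction i with
  | zero => exact h.measurable_init
  | succ i ih =>
    rw [show B (i + 1) = fun ω ↦ bufferStep M Γ (B i ω) (T i ω) (X i ω) from
      funext (h.update i)]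
    exact (measurable_bufferStep M Γ).comp
      (ih.prodMk ((h.measurable_slot i).prodMk (h.measurable_harvest i)))

theorem IsBufferProcess.indepFun_slot_harvest [IsProbabilityMeasure P]
    (h : IsBufferProcess P lam M Γ ρ X T B) (i : ℕ) :
    IndepFun (B i) (fun ω ↦ (T i ω, X i ω)) P := by
  obtain ⟨F, hF, hFB⟩ := h.exists_measurable_eq i
  have hZ : ∀ j, Measurable fun ω ↦ (X j ω, T j ω) := fun j ↦
    (h.measurable_harvest j).prodMk (h.measurable_slot j)
  have hpast : Measurable fun ω (j : Finset.range i) ↦ (X j ω, T j ω) :=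
    measurable_pi_lambda _ fun j ↦ hZ j
  have h₁ : IndepFun (fun ω (j : Finset.range i) ↦ (X j ω, T j ω))
      (fun ω ↦ (X i ω, T i ω)) P :=
    (h.indep_time.indepFun_finset (Finset.range i) {i} (by simp) hZ).comp measurable_id
      (measurable_pi_apply (⟨i, Finset.mem_singleton_self i⟩ : ({i} : Finset ℕ)))
  have h₂ : IndepFun (B 0)
      (fun ω ↦ ((fun j : Finset.range i ↦ (X j ω, T j ω)), (X i ω, T i ω))) P :=
    h.indep_init.comp measurable_id
      ((measurable_pi_lambda (fun (z : ℕ → ℝ × Slot) (j : Finset.range i) ↦ z j)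
        fun j ↦ measurable_pi_apply _).prodMk (measurable_pi_apply i))
  have h₃ := (indepFun_prodMk_of_indepFun_prodMk h.measurable_init hpast (hZ i) h₂ h₁).comp hF
    measurable_swap
  rw [show B i = fun ω ↦ F (B 0 ω, fun j ↦ (X j ω, T j ω)) from funext hFB]
  exact h₃

theorem IsBufferProcess.ae_nonneg (h : IsBufferProcess P lam M Γ ρ X T B) (i : ℕ) :
    ∀ᵐ ω ∂P, 0 ≤ B i ω := by
  induction i with
  | zero => exact h.init_nonneg
  | succ i ih =>
    have hX : ∀ᵐ ω ∂P, 0 ≤ X i ω :=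
      ae_of_ae_map (h.measurable_harvest i).aemeasurable
        (h.law_harvest i ▸ ae_nonneg_expMeasure lam)
    filter_upwards [ih, hX] with ω hB hX
    rw [h.update, bufferStep_eq_add]
    exact add_nonneg (levelAfterDischarge_nonneg hB _) hX

end BufferProcess

/-! ### Markov property and convergence. -/

section Convergence

variable {lam M Γ : ℝ} {ρ : Measure Slot} [IsProbabilityMeasure ρ]
  [IsProbabilityMeasure (expMeasure lam)]

theorem bind_bufferKernel {ν : Measure ℝ} (hν : ∀ᵐ x ∂ν, 0 ≤ x) :
    ν.bind (bufferKernel lam M Γ ρ) =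
      (ν.prod (ρ.prod (expMeasure lam))).map fun z ↦ bufferStep M Γ z.1 z.2.1 z.2.2 := by
  rw [bufferKernel, bind_randomMapKernel]
  refine Measure.map_congr ?_
  filter_upwards [Measure.quasiMeasurePreserving_fst.ae hν] with z hz
  rw [max_eq_left hz]

theorem IsBufferProcess.map_succ {Ω : Type*} [MeasurableSpace Ω] {P : Measure Ω}
    [IsProbabilityMeasure P] {X : ℕ → Ω → ℝ} {T : ℕ → Ω → Slot} {B : ℕ → Ω → ℝ}
    (h : IsBufferProcess P lam M Γ ρ X T B) (i : ℕ) :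
    P.map (B (i + 1)) = (P.map (B i)).bind (bufferKernel lam M Γ ρ) := by
  have hB := h.measurable i
  have hTX := (h.measurable_slot i).prodMk (h.measurable_harvest i)
  rw [bind_bufferKernel ((ae_map_iff hB.aemeasurable measurableSet_Ici).2 (h.ae_nonneg i)),
    ← h.law_slot i, ← h.law_harvest i,
    ← (indepFun_iff_map_prod_eq_prod_map_map (h.measurable_slot i).aemeasurable
      (h.measurable_harvest i).aemeasurable).1 (h.indep_harvest_slot i).symm,
    ← (indepFun_iff_map_prod_eq_prod_map_map hB.aemeasurable hTX.aemeasurable).1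
      (h.indepFun_slot_harvest i),
    Measure.map_map (measurable_bufferStep M Γ) (hB.prodMk hTX)]
  congr 1
  funext ω
  exact h.update i ω

/-- Every stationary law is the setwise limit of the laws of the buffer level. -/
theorem tendsto_iterate_bind_bufferKernel {b Q : ℝ} (hlam : 0 < lam) (hM : 0 < M) (hQ : Q < 0)
    (hb₀ : 0 < b) (heq : b * lam * Real.exp (Q * M) = b * lam + Q)
    (hb : ρ.real (dischargeSlots Γ) = b)
    {π : Measure ℝ} [IsProbabilityMeasure π] (hπ : π.bind (bufferKernel lam M Γ ρ) = π)
    {ν : ℕ → Measure ℝ} (hν₀ : IsProbabilityMeasure (ν 0))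
    (hν : ∀ n, ν (n + 1) = (ν n).bind (bufferKernel lam M Γ ρ))
    {A : Set ℝ} (hA : MeasurableSet A) : Tendsto (fun n ↦ ν n A) atTop (𝓝 (π A)) := by
  have hb₁ : b ≤ 1 := hb ▸ measureReal_le_one
  have hc : 0 < b * lam := mul_pos hb₀ hlam
  have hbQ : 0 < b * lam + Q := heq ▸ mul_pos hc (Real.exp_pos _)
  have hbl : b * lam ≤ lam := mul_le_of_le_one_left hlam.le hb₁
  set s := -Q / 2 with hs_def
  have hs : 0 < s := by linarith
  have hs' : s < lam := by linarith
  set r := Real.exp (-(s * M)) with hr_def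
  have hr₀ : 0 < r := Real.exp_pos _
  have hr₁ : r < 1 := by
    rw [hr_def, Real.exp_lt_one_iff]
    exact neg_neg_of_pos (mul_pos hs hM)
  have hr₂ : Real.exp (Q * M) = r * r := by
    rw [hr_def, ← Real.exp_add]
    congr 1
    rw [hs_def]
    ring
  have hcoef : 0 ≤ 1 - b + b * r := by nlinarith
  have hpos : 0 < lam - s := sub_pos.2 hs'
  -- With `r * r = exp (Q * M)`, the equation for `Q` gives `2 * s = b * lam * (1 - r * r)`, so the
  -- claim `s < b * lam * (1 - r)` reduces to `0 < (1 - r) ^ 2`.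
  have hγ : (1 - b + b * r) * (lam / (lam - s)) < 1 := by
    rw [mul_div_assoc', div_lt_one hpos]
    rw [hr₂] at heq
    have : 0 < b * lam * ((1 - r) * (1 - r)) := by
      have := sub_pos.2 hr₁
      positivity
    linarith
  have : IsMarkovKernel (bufferKernel lam M Γ ρ) := isMarkovKernel_randomMapKernel _
  refine tendsto_iterate_bind_apply (V := fun x ↦ Real.exp (s * max x 0))
    (γ := (1 - b + b * r) * (lam / (lam - s))) (C := Real.exp (s * M) * (lam / (lam - s)))
    (fun x ↦ (Real.exp_pos _).le)
    (integrable_exp_mul_max_bufferKernel hlam hM.le hs.le hs') (by positivity) hγ (by positivity)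
    (fun x ↦ ?_) (fun R ↦ ?_) hπ hν₀ hν hA
  · have h := integral_exp_mul_max_bufferKernel_le (ρ := ρ) (Γ := Γ) hlam hM.le hs.le hs' x
    rwa [hb] at h
  -- A bound `R` on the Lyapunov function bounds the clamped level by `R / s`, since `t + 1 ≤ exp
  -- t`.
  · refine ⟨(expMeasure lam).restrict (Set.Ici (R / s)), inferInstance,
      restrict_Ici_expMeasure_ne_zero hlam _, fun x hx ↦
      restrict_Ici_expMeasure_le_bufferKernel hlam hM.le ?_⟩
    rw [le_div_iff₀ hs]
    linarith [Real.add_one_le_exp (s * max x 0)]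

end Convergence

/-! ### The main theorem. -/

theorem theorem1 (lam M Γ : ℝ) (hlam : 0 < lam) (hM : 0 < M)
    (ρ : Measure Slot) [IsProbabilityMeasure ρ]
    (b Q : ℝ) (hb : b = dischargeProb ρ Γ) (hQ : Q = decayRate b lam M)
    (hψ : 1 < lam * M * b) :
    -- the exponent
    Q < 0 ∧ b * lam * Real.exp (Q * M) = b * lam + Q ∧
    (∀ q : ℝ, q ≠ 0 → b * lam * Real.exp (q * M) = b * lam + q → q = Q) ∧
    -- the density is a probability density, and its law is the only stationary one
    (∀ x, 0 ≤ limitDensity b lam M Q x) ∧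
    IsProbabilityMeasure (limitLaw b lam M Q) ∧
    IsStationaryLaw lam M Γ ρ (limitLaw b lam M Q) ∧
    (∀ ν : Measure ℝ, IsProbabilityMeasure ν → ν (Set.Iio 0) = 0 →
      IsStationaryLaw lam M Γ ρ ν → ν = limitLaw b lam M Q) ∧
    -- the law of the buffer level converges to it, whatever the initial level
    (∀ (Ω : Type*) [MeasurableSpace Ω] (P : Measure Ω) [IsProbabilityMeasure P]
      (X : ℕ → Ω → ℝ) (T : ℕ → Ω → Slot) (B : ℕ → Ω → ℝ),
      IsBufferProcess P lam M Γ ρ X T B →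
      ∀ A : Set ℝ, MeasurableSet A →
        Tendsto (fun i ↦ P {ω | B i ω ∈ A}) atTop (𝓝 (limitLaw b lam M Q A))) := by
  have hbρ : ρ.real (dischargeSlots Γ) = b := by
    rw [hb, dischargeProb_eq_real_dischargeSlots]
  have hb₁ : b ≤ 1 := hbρ ▸ measureReal_le_one
  have hb₀ : 0 < b := by
    by_contra h
    have := mul_nonpos_of_nonneg_of_nonpos (mul_pos hlam hM).le (not_lt.1 h)
    linarith
  have hc : 0 < b * lam := mul_pos hb₀ hlam
  obtain ⟨hQ₀, heq⟩ : Q < 0 ∧ b * lam * Real.exp (Q * M) = b * lam + Q :=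
    hQ ▸ decayRate_spec hM (by linarith)
  have hbQ : 0 < b * lam + Q := heq ▸ mul_pos hc (Real.exp_pos _)
  have hexp := isProbabilityMeasure_expMeasure hlam
  have hprob := isProbabilityMeasure_limitLaw hM hQ₀ hc heq
  have hstat := isStationaryLaw_limitLaw hlam hM hQ₀ hb₀ hb₁ heq hbρ
  have hlaw₀ : ∀ᵐ x ∂limitLaw b lam M Q, 0 ≤ x := by
    rw [limitLaw, ae_withDensity_iff
      (continuous_limitDensity hM hc heq).measurable.ennreal_ofReal]
    refine Eventually.of_forall fun x hx ↦ not_lt.1 fun h ↦ hx ?_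
    rw [limitDensity_of_neg h, ENNReal.ofReal_zero]
  have hinv : (limitLaw b lam M Q).bind (bufferKernel lam M Γ ρ) = limitLaw b lam M Q :=
    (bind_bufferKernel hlaw₀).trans hstat
  refine ⟨hQ₀, heq, fun q hq h ↦ eq_of_mul_exp_eq hc hM hq hQ₀.ne h heq,
    limitDensity_nonneg hM hQ₀ hbQ, hprob, hstat, fun ν hν hν₀ hνstat ↦ ?_, ?_⟩
  · have hν₀' : ∀ᵐ x ∂ν, 0 ≤ x := by
      simp only [ae_iff, not_le]
      exact hν₀
    ext A hA
    -- Started from `ν`, the chain has constant law `ν`, which must also converge to the limiting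
    -- law.
    exact tendsto_nhds_unique tendsto_const_nhds (tendsto_iterate_bind_bufferKernel hlam hM hQ₀ hb₀
      heq hbρ hinv (ν := fun _ ↦ ν) hν (fun _ ↦ ((bind_bufferKernel hν₀').trans hνstat).symm) hA)
  · intro Ω _ P _ X T B h A hA
    have hlim := tendsto_iterate_bind_bufferKernel hlam hM hQ₀ hb₀ heq hbρ hinv
      (ν := fun i ↦ P.map (B i))
      (Measure.isProbabilityMeasure_map (h.measurable 0).aemeasurable) h.map_succ hA
    refine hlim.congr fun i ↦ ?_
    rw [Measure.map_apply (h.measurable i) hA]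
    rfl
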